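/- Let $\mathbb S=\{J\in\mathbb H: J^2=-1\}$. Let $D\subseteq\mathbb C$ be an open set invariant under complex conjugation, and let $$\Omega=\Omega_D=\{\alpha+J\beta\in\mathbb H:\ \alpha,\beta\in\mathbb R,\ \alpha+i\beta\in D,\ J\in\mathbb S\}$$ be the corresponding axially symmetric open subset of the quaternions $\mathbb H\cong\mathbb R^4$. A stem function on $D$ is a map $F=F_1+\iota F_2:D\to\mathbb H\otimes_{\mathbb R}\mathbb C$ (with $F_1,F_2:D\to\mathbb H$ and $\iota=1\otimes i$) such that $F_1(\bar z)=F_1(z)$ and $F_2(\bar z)=-F_2(z)$ for all $z\in D$. It induces the slice function $f=\mathcal I(F):\Omega\to\mathbb H$, $f(\alpha+J\beta)=F_1(\alpha+i\beta)+J\,F_2(\alpha+i\beta)$. Let * $\mathcal{SR}(\Omega)$ be the set of slice-regular functions on $\Omega$, i.e. the slice functions $\mathcal I(F)$ with $F$ holomorphic with respect to the complex structure on $\mathbb H\otimes\mathbb C$ given by multiplication by $\iota$; * $\mathcal{AM}(\Omega)$ be the set of axially monogenic functions on $\Omega$, i.e. the slice functions $g=\mathcal I(G)$ with $G$ of class $C^1$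 on $D$ such that $$\tfrac12\left(\frac{\partial g}{\partial x_0}+i\frac{\partial g}{\partial x_1}+j\frac{\partial g}{\partial x_2}+k\frac{\partial g}{\partial x_3}\right)=0\quad\text{on }\Omega.$$ Assume that every connected component of $D$ is simply connected. Then the Laplacian $\Delta=\sum_{n=0}^3\partial^2/\partial x_n^2$ of $\mathbb R^4$ is a well-defined map $$\Delta:\mathcal{SR}(\Omega)\to\mathcal{AM}(\Omega)$$ (every $f\in\mathcal{SR}(\Omega)$ is of class $C^2$ on $\Omega$ and $\Delta f\in\mathcal{AM}(\Omega)$), and this map is surjective: for every $g\in\mathcal{AM}(\Omega)$ there is $f\in\mathcal{SR}(\Omega)$ with $\Delta f=g$ on $\Omega$. -/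

import Mathlib

open scoped Quaternion

noncomputable section

namespace SliceQuaternion

/-- The sphere of quaternionic imaginary units. -/
def imagUnits : Set ℍ := {J | J ^ 2 = -1}

/-- The map `a + i b ↦ a + J b` from `ℂ` to `ℍ`. -/
def slicePoint (J : ℍ) (z : ℂ) : ℍ := (z.re : ℍ) + J * (z.im : ℍ)

/-- The axially symmetric set `Ω_D`, the union over all imaginary units `J` of the copies of `D`
in the planes `ℂ_J`. -/
def axialSet (D : Set ℂ) : Set ℍ := ⋃ J ∈ imagUnits, slicePoint J '' D

/-- The set `D` is invariant under complex conjugation. -/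
def ConjInvariant (D : Set ℂ) : Prop := ∀ z ∈ D, star z ∈ D

/-- Conjugation of `ℍ ⊗ ℂ` in the second factor. An element `a + ι b` of `ℍ ⊗ ℂ` (with `a`, `b`
in `ℍ`) is represented by the pair `(a, b)`. -/
def stemConj (w : ℍ × ℍ) : ℍ × ℍ := (w.1, -w.2)

/-- Multiplication by the imaginary unit of the second factor of `ℍ ⊗ ℂ`:
`ι (a + ι b) = -b + ι a`. -/
def stemMulI (w : ℍ × ℍ) : ℍ × ℍ := (-w.2, w.1)

/-- `F = F₁ + ι F₂` is a stem function on `D`. -/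
def IsStemOn (F : ℂ → ℍ × ℍ) (D : Set ℂ) : Prop :=
  ∀ z ∈ D, F (star z) = stemConj (F z)

/-- On `Ω_D`, `f` is the slice function induced by `F`: `f (α + J β) = F₁ z + J F₂ z` for
`z = α + i β` in `D` and every imaginary unit `J`. -/
def IsInducedBy (f : ℍ → ℍ) (F : ℂ → ℍ × ℍ) (D : Set ℂ) : Prop :=
  ∀ J ∈ imagUnits, ∀ z ∈ D, f (slicePoint J z) = (F z).1 + J * (F z).2

/-- `F` is holomorphic on the open set `D`, for the complex structure `stemMulI` on `ℍ ⊗ ℂ`: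
it is real differentiable and its differential commutes with the complex structures. -/
def IsHolomorphicStemOn (F : ℂ → ℍ × ℍ) (D : Set ℂ) : Prop :=
  ∀ z ∈ D, DifferentiableAt ℝ F z ∧
    ∀ v : ℂ, fderiv ℝ F z (Complex.I * v) = stemMulI (fderiv ℝ F z v)

/-- The class `SR(Ω_D)` of slice-regular functions. Only the values on `Ω_D` matter. -/
def sliceRegular (D : Set ℂ) : Set (ℍ → ℍ) :=
  {f | ∃ F : ℂ → ℍ × ℍ, IsStemOn F D ∧ IsHolomorphicStemOn F D ∧ IsInducedBy f F D}

/-- The class of slice functions on `Ω_D` that are induced by stem functions of class `C¹`. -/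
def sliceC1 (D : Set ℂ) : Set (ℍ → ℍ) :=
  {f | ∃ F : ℂ → ℍ × ℍ, IsStemOn F D ∧ ContDiffOn ℝ 1 F D ∧ IsInducedBy f F D}

/-- The quaternion unit `i`. -/
def unitI : ℍ := ⟨0, 1, 0, 0⟩

/-- The quaternion unit `j`. -/
def unitJ : ℍ := ⟨0, 0, 1, 0⟩

/-- The quaternion unit `k`. -/
def unitK : ℍ := ⟨0, 0, 0, 1⟩

/-- The Cauchy-Riemann-Fueter operator
`(1/2) (∂/∂x₀ + i ∂/∂x₁ + j ∂/∂x₂ + k ∂/∂x₃)`. -/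
def cauchyRiemannFueter (f : ℍ → ℍ) (x : ℍ) : ℍ :=
  (2⁻¹ : ℝ) • (fderiv ℝ f x 1 + unitI * fderiv ℝ f x unitI
    + unitJ * fderiv ℝ f x unitJ + unitK * fderiv ℝ f x unitK)

/-- `f` is (left) monogenic on the open set `Ω`: the partial derivatives make sense and the
Cauchy-Riemann-Fueter operator annihilates `f`. -/
def IsMonogenicOn (f : ℍ → ℍ) (Ω : Set ℍ) : Prop :=
  ∀ x ∈ Ω, DifferentiableAt ℝ f x ∧ cauchyRiemannFueter f x = 0

/-- The class `AM(Ω_D)` of axially monogenic functions: monogenic slice functions induced by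
stem functions of class `C¹`. (Such slice functions are automatically differentiable, so the
differentiability in `IsMonogenicOn` is no restriction here.) -/
def axiallyMonogenic (D : Set ℂ) : Set (ℍ → ℍ) :=
  {f | f ∈ sliceC1 D ∧ IsMonogenicOn f (axialSet D)}

end SliceQuaternion

end

/-! Off the real axis a slice function is F₁ + J F₂ with J = Im x / |Im x| and β = |Im x|.
Differentiating J costs only a term 2F₂/β, so twice the Cauchy-Riemann-Fueter operator sends F to
(∂_αF₁ - ∂_βF₂ - 2F₂/β) + J(∂_αF₂ + ∂_βF₁) (`fueterOp_sliceMap`). For holomorphic F only -2h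
survives, where h = F₂/β. Since Δ factors through the operator and its conjugate, Δf has the stem
function (-2∂_αh, 2∂_βh) (`laplacian_of_regular`). As βh = F₂ is harmonic, h_αα + h_ββ + (2/β)h_β =
0, which is exactly monogenicity of Δf. Real points follow by continuity, since f is given there by
a quaternionic power series with real coefficients (`analyticAt_sliceMap_realStem`).

For surjectivity, monogenicity of g with stem function (A, B) reads B_α + A_β = 0 and β(A_α - B_β) =
2B (`IsStemOn.monogenic_equations`). The first equation says that -A/2 dα + B/2 dβ is closed; let h
be a primitive. The second says that the Cauchy-Riemann equations for a stem function (u, βh) can be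
solved for u. Both primitives exist because the components of D are simply connected, and can be
taken even in β (`exists_even_primitive`). Then (u, βh) induces the required f. -/

section

open Set Filter Topology


/-! ### Closed one-forms on simply connected open sets -/

/-- The total space of the covering of `s` by the germs of primitives. -/
structure PrimitiveCover {E : Type*} (s : Set E) (F : Type*) where
  base : s
  value : F

namespace PrimitiveCover

variable {E F : Type*} [TopologicalSpace E] [Add F] {s : Set E}

/-- The graph of `h + c` over `V`. -/
def sheet (h : E → F) (V : Set E) (c : F) : Set (PrimitiveCover s F) :=
  {e | (e.base : E) ∈ V ∧ e.value = h e.base + c}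

/-- The finest topology for which all the sections `y ↦ (y, h i y + c)` on the sets `V i` are
continuous. -/
@[reducible]
def topology {ι : Type*} (h : ι → E → F) (V : ι → Set E)
    (hV : ∀ i, IsOpen {y : s | (y : E) ∈ V i}) :
    TopologicalSpace (PrimitiveCover s F) where
  IsOpen W := ∀ i c, IsOpen {y : s | (y : E) ∈ V i ∧ (⟨y, h i y + c⟩ : PrimitiveCover s F) ∈ W}
  isOpen_univ i c := by
    simpa using hV i
  isOpen_inter W W' hW hW' i c := by
    convert! (hW i c).inter (hW' i c) using 1
    ext y
    simp only [mem_ofPred_eq, mem_inter_iff]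
    tauto
  isOpen_sUnion S hS i c := by
    convert! isOpen_biUnion fun W hW => hS W hW i c using 1
    ext y
    simp only [mem_ofPred_eq, mem_iUnion, mem_sUnion]
    tauto

end PrimitiveCover

/-- Two primitives of the same form differ by a locally constant function. -/
theorem isOpen_setOf_primitive_eq {E F : Type*} [NormedAddCommGroup E] [NormedSpace ℝ E]
    [NormedAddCommGroup F] [NormedSpace ℝ F] {ω : E → E →L[ℝ] F} {h₁ h₂ : E → F} {V : Set E}
    (hV : IsOpen V) (hh₁ : ∀ y ∈ V, HasFDerivAt h₁ (ω y) y)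
    (hh₂ : ∀ y ∈ V, HasFDerivAt h₂ (ω y) y) (c₁ c₂ : F) :
    IsOpen {y | y ∈ V ∧ h₁ y + c₁ = h₂ y + c₂} := by
  rw [Metric.isOpen_iff]
  rintro y ⟨hyV, hy⟩
  obtain ⟨r, hr, hrV⟩ := Metric.isOpen_iff.1 hV y hyV
  refine ⟨r, hr, fun z hz => ⟨hrV hz, ?_⟩⟩
  have hd : ∀ w ∈ Metric.ball y r,
      HasFDerivWithinAt (fun w => h₁ w - h₂ w) (0 : E →L[ℝ] F) (Metric.ball y r) w := by
    intro w hw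
    rw [← sub_self (ω w)]
    exact ((hh₁ w (hrV hw)).sub (hh₂ w (hrV hw))).hasFDerivWithinAt
  have h0 := (convex_ball y r).norm_image_sub_le_of_norm_hasFDerivWithin_le (C := 0) hd
    (by simp) (Metric.mem_ball_self hr) hz
  rw [zero_mul, norm_le_zero_iff, sub_eq_zero] at h0
  have h1 : h₁ y - h₂ y = c₂ - c₁ := by
    rw [sub_eq_sub_iff_add_eq_add, hy, add_comm]
  rw [h1, sub_eq_sub_iff_add_eq_add] at h0
  rw [h0, add_comm]

/-- A closed `1`-form on a simply connected open set is exact. -/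
theorem IsSimplyConnected.exists_forall_hasFDerivAt {E F : Type*}
    [NormedAddCommGroup E] [NormedSpace ℝ E] [NormedAddCommGroup F] [NormedSpace ℝ F]
    [CompleteSpace F]
    {ω : E → E →L[ℝ] F} {s : Set E}
    (hs : IsSimplyConnected s) (hso : IsOpen s) (hω : DifferentiableOn ℝ ω s)
    (hdω : ∀ a ∈ s, ∀ x y, fderiv ℝ ω a x y = fderiv ℝ ω a y x) :
    ∃ f : E → F, ∀ a ∈ s, HasFDerivAt f (ω a) a := by
  have hloc : ∀ x : s, ∃ (h : E → F) (V : Set E), IsOpen V ∧ (x : E) ∈ V ∧ V ⊆ s ∧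
      ∀ a ∈ V, HasFDerivAt h (ω a) a := by
    intro x
    obtain ⟨r, hr, hrs⟩ := Metric.isOpen_iff.1 hso x x.2
    obtain ⟨h, hh⟩ := (convex_ball (x : E) r).exists_forall_hasFDerivAt_of_fderiv_symmetric
      Metric.isOpen_ball (hω.mono hrs) (fun a ha => hdω a (hrs ha))
    exact ⟨h, _, Metric.isOpen_ball, Metric.mem_ball_self hr, hrs, hh⟩
  choose h V hVo hxV hVs hh using hloc
  let _ : TopologicalSpace (PrimitiveCover s F) := PrimitiveCover.topology h V fun x =>
    (hVo x).preimage continuous_subtype_val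
  -- The projection to the base is a homeomorphism from each sheet onto its image. A sheet meets
  -- another local section in an open set because two local primitives differ by a locally constant
  -- function.
  have hopen : ∀ (x : s) (c : F) {W : Set s}, W ⊆ Subtype.val ⁻¹' V x →
      (IsOpen W ↔ IsOpen (PrimitiveCover.base ⁻¹' W ∩
        PrimitiveCover.sheet (h x) (V x) c : Set (PrimitiveCover s F))) := by
    intro x c W hW
    constructor
    · intro hWo x' c'
      have h1 := (isOpen_setOf_primitive_eq ((hVo x').inter (hVo x))
        (fun y hy => hh x' y hy.1) (fun y hy => hh x y hy.2) c' c).preimage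
          (continuous_subtype_val (p := (· ∈ s)))
      convert! hWo.inter h1 using 1
      ext y
      simp only [PrimitiveCover.sheet, mem_ofPred_eq, mem_inter_iff, mem_preimage]
      tauto
    · intro hWo
      convert! hWo x c using 1
      ext y
      simp only [PrimitiveCover.sheet, mem_ofPred_eq, mem_inter_iff, mem_preimage, and_true]
      exact ⟨fun hy => ⟨hW hy, hy, hW hy⟩, fun hy => hy.2.1⟩
  have hcov : IsCoveringMap (PrimitiveCover.base : PrimitiveCover s F → s) := by
    intro x
    -- The fibre is `F` with the discrete topology: the sheets over `V x` are indexed by the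
    -- constant of integration.
    let _ : TopologicalSpace F := ⊥
    have : DiscreteTopology F := ⟨rfl⟩
    have : Nonempty (s → PrimitiveCover s F) := ⟨fun y => ⟨y, 0⟩⟩
    refine (IsEvenlyCovered.of_trivialization (I := F) (t := IsOpen.trivializationDiscrete
      (fun c : F => PrimitiveCover.sheet (h x) (V x) c) (Subtype.val ⁻¹' V x)
      ((hVo x).preimage continuous_subtype_val) (fun c W hW => hopen x c hW)
      ?_ ?_ ?_ ?_) (hxV x)).to_isEvenlyCovered_preimage
    · rintro c ⟨y, v⟩ ⟨_, hv⟩ ⟨y', v'⟩ ⟨_, hv'⟩ (rfl : y = y')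
      simp only at hv hv'
      rw [hv, hv']
    · intro c y hy
      exact ⟨⟨y, h x y + c⟩, ⟨hy, rfl⟩, rfl⟩
    · intro c c' hcc'
      refine Set.disjoint_left.2 fun e he he' => hcc' ?_
      exact add_left_cancel (he.2.symm.trans he'.2)
    · intro e he
      exact mem_iUnion.2 ⟨e.value - h x e.base, he, by abel⟩
  have : SimplyConnectedSpace s := hs
  have : LocallyPathConnectedSpace s := hso.locallyPathConnectedSpace
  obtain ⟨x₀, hx₀⟩ := hs.nonempty
  -- Simple connectedness lifts the identity of `s` to a global section; its values form the
  -- primitive.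
  obtain ⟨Φ, ⟨-, hΦ⟩, -⟩ := hcov.existsUnique_continuousMap_lifts (ContinuousMap.id s) ⟨x₀, hx₀⟩
    ⟨⟨x₀, hx₀⟩, 0⟩ rfl
  have hΦ' : ∀ y, (Φ y).base = y := fun y => congrFun hΦ y
  classical
  refine ⟨fun y => if hy : y ∈ s then (Φ ⟨y, hy⟩).value else 0, fun a ha => ?_⟩
  set x : s := ⟨a, ha⟩
  set c := (Φ x).value - h x a
  -- The sheet through `Φ x` is open, so near `a` the section stays in it and equals `h x + c`.
  have hN : IsOpen (PrimitiveCover.base ⁻¹' (Subtype.val ⁻¹' V x) ∩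
        PrimitiveCover.sheet (h x) (V x) c : Set (PrimitiveCover s F)) :=
    (hopen x c subset_rfl).1 ((hVo x).preimage continuous_subtype_val)
  have hN' := hN.preimage Φ.continuous
  have hmem : ∀ᶠ y in 𝓝 x, (Φ y).value = h x y + c := by
    filter_upwards [hN'.mem_nhds ⟨by simpa [hΦ'] using! hxV x, by simpa [hΦ'] using! hxV x, by
      simp [hΦ', c, x]⟩] with y hy
    have := hy.2.2
    rwa [hΦ'] at this
  have hev : (fun y => if hy : y ∈ s then (Φ ⟨y, hy⟩).value else 0) =ᶠ[𝓝 a]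
      fun y => h x y + c := by
    have := (hso.isOpenEmbedding_subtypeVal.map_nhds_eq x)
    rw [Filter.EventuallyEq, show a = ((x : s) : E) from rfl, ← this, Filter.eventually_map]
    filter_upwards [hmem] with y hy
    rw [dif_pos y.2]
    exact hy
  exact ((hh x a (hxV x)).add_const c).congr_of_eventuallyEq hev

/-- A closed `1`-form on an open set with simply connected components is exact. -/
theorem exists_forall_hasFDerivAt_of_isSimplyConnected_components {E F : Type*}
    [NormedAddCommGroup E] [NormedSpace ℝ E] [NormedAddCommGroup F] [NormedSpace ℝ F]
    [CompleteSpace F]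
    {ω : E → E →L[ℝ] F} {s : Set E}
    (hs : ∀ z ∈ s, IsSimplyConnected (connectedComponentIn s z))
    (hso : IsOpen s) (hω : DifferentiableOn ℝ ω s)
    (hdω : ∀ a ∈ s, ∀ x y, fderiv ℝ ω a x y = fderiv ℝ ω a y x) :
    ∃ f : E → F, ∀ a ∈ s, HasFDerivAt f (ω a) a := by
  -- The primitive is chosen as a function of the component as a set, so that all points of one
  -- component share the same choice.
  have key : ∀ C : Set E, ∃ f : E → F, ∀ z ∈ s, C = connectedComponentIn s z →
      ∀ a ∈ C, HasFDerivAt f (ω a) a := by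
    intro C
    by_cases hC : ∃ z ∈ s, C = connectedComponentIn s z
    · obtain ⟨z, hz, rfl⟩ := hC
      have hsub := connectedComponentIn_subset s z
      obtain ⟨f, hf⟩ := (hs z hz).exists_forall_hasFDerivAt hso.connectedComponentIn
        (hω.mono hsub) (fun a ha => hdω a (hsub ha))
      exact ⟨f, fun _ _ _ => hf⟩
    · exact ⟨0, fun z hz h => (hC ⟨z, hz, h⟩).elim⟩
  choose f hf using key
  refine ⟨fun z => f (connectedComponentIn s z) z, fun a ha => ?_⟩
  refine (hf _ a ha rfl a (mem_connectedComponentIn ha)).congr_of_eventuallyEq ?_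
  filter_upwards [hso.connectedComponentIn.mem_nhds (mem_connectedComponentIn ha)] with y hy
  rw [connectedComponentIn_eq hy]

end

/-! ### Imaginary units and slice coordinates -/

noncomputable section

open scoped Quaternion
open Set Filter Topology Quaternion

namespace SliceQuaternion

@[simp] theorem unitI_re : unitI.re = 0 := rfl
@[simp] theorem unitI_imI : unitI.imI = 1 := rfl
@[simp] theorem unitI_imJ : unitI.imJ = 0 := rfl
@[simp] theorem unitI_imK : unitI.imK = 0 := rfl
@[simp] theorem unitJ_re : unitJ.re = 0 := rfl
@[simp] theorem unitJ_imI : unitJ.imI = 0 := rfl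
@[simp] theorem unitJ_imJ : unitJ.imJ = 1 := rfl
@[simp] theorem unitJ_imK : unitJ.imK = 0 := rfl
@[simp] theorem unitK_re : unitK.re = 0 := rfl
@[simp] theorem unitK_imI : unitK.imI = 0 := rfl
@[simp] theorem unitK_imJ : unitK.imJ = 0 := rfl
@[simp] theorem unitK_imK : unitK.imK = 1 := rfl

/-- The real part as a continuous linear map. -/
def reL : ℍ →L[ℝ] ℝ :=
  LinearMap.toContinuousLinearMap (QuaternionAlgebra.reₗ (-1 : ℝ) 0 (-1))

@[simp] theorem reL_apply (x : ℍ) : reL x = x.re := rfl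

/-- The imaginary part as a continuous linear map. -/
def imL : ℍ →L[ℝ] ℍ :=
  ContinuousLinearMap.id ℝ ℍ - reL.smulRight (1 : ℍ)

@[simp] theorem imL_apply (x : ℍ) : imL x = x.im := by
  have : x - x.re • (1 : ℍ) = x.im := by ext <;> simp
  simpa [imL] using this

/-- The point `re x + i ‖im x‖` of the closed upper half plane. -/
def toPlane (x : ℍ) : ℂ := ⟨x.re, ‖x.im‖⟩

/-- The imaginary unit `im x / ‖im x‖`, or `0` if `x` is real. -/
def toUnit (x : ℍ) : ℍ := ‖x.im‖⁻¹ • x.im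

/-- The slice function on the whole of `ℍ` induced by the values of `F` on the closed upper half
plane. -/
def sliceMap (F : ℂ → ℍ × ℍ) (x : ℍ) : ℍ := (F (toPlane x)).1 + toUnit x * (F (toPlane x)).2

theorem continuous_toPlane : Continuous toPlane := by
  have : toPlane = fun x => Complex.equivRealProdCLM.symm (x.re, ‖x.im‖) := by
    ext1 x
    apply Complex.ext <;> simp [toPlane]
  rw [this]
  exact Complex.equivRealProdCLM.symm.continuous.comp
    (continuous_re.prodMk continuous_im.norm)

theorem mem_imagUnits_iff {J : ℍ} : J ∈ imagUnits ↔ J.re = 0 ∧ ‖J‖ = 1 := by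
  have hn : ‖J‖ = 1 ↔ J.re ^ 2 + J.imI ^ 2 + J.imJ ^ 2 + J.imK ^ 2 = 1 := by
    rw [← normSq_def', normSq_eq_norm_mul_self]
    constructor
    · intro h; rw [h, one_mul]
    · intro h; nlinarith [norm_nonneg J]
  rw [hn, imagUnits, mem_ofPred_eq, sq, Quaternion.ext_iff]
  simp only [re_mul, imI_mul, imJ_mul, imK_mul, re_neg, imI_neg, imJ_neg, imK_neg, re_one, imI_one,
    imJ_one, imK_one]
  constructor
  · rintro ⟨h0, h1, h2, h3⟩
    have : J.re = 0 := by
      by_contra hne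
      have e1 : J.imI = 0 := by
        apply mul_left_cancel₀ hne; linarith
      have e2 : J.imJ = 0 := by
        apply mul_left_cancel₀ hne; linarith
      have e3 : J.imK = 0 := by
        apply mul_left_cancel₀ hne; linarith
      rw [e1, e2, e3] at h0
      nlinarith [mul_self_nonneg J.re]
    refine ⟨this, ?_⟩
    rw [this] at h0 ⊢
    linarith
  · rintro ⟨h0, h1⟩
    rw [h0] at h1 ⊢
    refine ⟨by linarith, by ring, by ring, by ring⟩

theorem mul_self_of_mem_imagUnits {J : ℍ} (hJ : J ∈ imagUnits) : J * J = -1 := by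
  rw [← sq]; exact hJ

theorem neg_mem_imagUnits {J : ℍ} (hJ : J ∈ imagUnits) : -J ∈ imagUnits := by
  simpa [imagUnits] using! hJ

theorem unitI_mem_imagUnits : unitI ∈ imagUnits := by
  rw [mem_imagUnits_iff]
  refine ⟨rfl, (sq_eq_sq₀ (norm_nonneg _) zero_le_one).1 ?_⟩
  rw [sq, ← normSq_eq_norm_mul_self, normSq_def']
  simp

theorem toUnit_mem_imagUnits {x : ℍ} (hx : x.im ≠ 0) : toUnit x ∈ imagUnits := by
  rw [mem_imagUnits_iff]
  refine ⟨by simp [toUnit], ?_⟩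
  rw [toUnit, norm_smul, norm_inv, norm_norm, inv_mul_cancel₀ (norm_ne_zero_iff.2 hx)]

theorem im_slicePoint {J : ℍ} (hJ : J ∈ imagUnits) (z : ℂ) : (slicePoint J z).im = z.im • J := by
  have h := (mem_imagUnits_iff.1 hJ).1
  ext <;> simp [slicePoint, h, mul_comm]

theorem re_slicePoint {J : ℍ} (hJ : J ∈ imagUnits) (z : ℂ) : (slicePoint J z).re = z.re := by
  have h := (mem_imagUnits_iff.1 hJ).1
  simp [slicePoint, h]

theorem norm_im_slicePoint {J : ℍ} (hJ : J ∈ imagUnits) (z : ℂ) :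
    ‖(slicePoint J z).im‖ = |z.im| := by
  rw [im_slicePoint hJ, norm_smul, (mem_imagUnits_iff.1 hJ).2, mul_one, Real.norm_eq_abs]

theorem slicePoint_toPlane {J x : ℍ} (h : x.im = ‖x.im‖ • J) : slicePoint J (toPlane x) = x := by
  have : x = x.re + x.im := (re_add_im x).symm
  conv_rhs => rw [this, h]
  simp only [slicePoint, toPlane]
  rw [mul_coe_eq_smul]

theorem slicePoint_neg_star (J : ℍ) (z : ℂ) : slicePoint (-J) (star z) = slicePoint J z := by
  simp [slicePoint]

theorem exists_mem_imagUnits_im_eq (x : ℍ) : ∃ J ∈ imagUnits, x.im = ‖x.im‖ • J := by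
  by_cases hx : x.im = 0
  · exact ⟨unitI, unitI_mem_imagUnits, by simp [hx]⟩
  · refine ⟨toUnit x, toUnit_mem_imagUnits hx, ?_⟩
    rw [toUnit, smul_smul, mul_inv_cancel₀ (norm_ne_zero_iff.2 hx), one_smul]

theorem toPlane_slicePoint_of_nonneg {J : ℍ} (hJ : J ∈ imagUnits) {z : ℂ} (hz : 0 ≤ z.im) :
    toPlane (slicePoint J z) = z := by
  apply Complex.ext
  · exact re_slicePoint hJ z
  · exact (norm_im_slicePoint hJ z).trans (abs_of_nonneg hz)

theorem toUnit_slicePoint_of_pos {J : ℍ} (hJ : J ∈ imagUnits) {z : ℂ} (hz : 0 < z.im) :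
    toUnit (slicePoint J z) = J := by
  rw [toUnit, norm_im_slicePoint hJ, im_slicePoint hJ, abs_of_pos hz, smul_smul,
    inv_mul_cancel₀ hz.ne', one_smul]

/-- Every point of `ℍ` of the form `α + J β` has this form with `β ≥ 0`. -/
theorem slicePoint_nonneg_induction {D : Set ℂ} (hD : ConjInvariant D) {P : ℍ → ℂ → Prop}
    (hneg : ∀ J ∈ imagUnits, ∀ z ∈ D, P J z → P (-J) (star z))
    (hpos : ∀ J ∈ imagUnits, ∀ z ∈ D, 0 ≤ z.im → P J z) :
    ∀ J ∈ imagUnits, ∀ z ∈ D, P J z := by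
  intro J hJ z hz
  rcases le_total 0 z.im with h | h
  · exact hpos J hJ z hz h
  · simpa using hneg _ (neg_mem_imagUnits hJ) _ (hD z hz)
      (hpos _ (neg_mem_imagUnits hJ) _ (hD z hz) (by simpa using h))

/-- The pairs (J, z) and (-J, z̄) give the same point, so by symmetry of `D` only the representative
with β ≥ 0 matters. -/
theorem mem_axialSet_iff {D : Set ℂ} (hD : ConjInvariant D) {x : ℍ} :
    x ∈ axialSet D ↔ toPlane x ∈ D := by
  constructor
  · intro hx
    simp only [axialSet, mem_iUnion, mem_image] at hx
    obtain ⟨J, hJ, z, hz, rfl⟩ := hx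
    refine slicePoint_nonneg_induction hD (P := fun J z => toPlane (slicePoint J z) ∈ D)
      ?_ ?_ J hJ z hz
    · intro J _ z _ h
      rwa [slicePoint_neg_star]
    · intro J hJ z hz h
      rwa [toPlane_slicePoint_of_nonneg hJ h]
  · intro hx
    obtain ⟨J, hJ, h⟩ := exists_mem_imagUnits_im_eq x
    simp only [axialSet, mem_iUnion, mem_image]
    exact ⟨J, hJ, _, hx, slicePoint_toPlane h⟩

theorem slicePoint_mem_axialSet {D : Set ℂ} {J : ℍ} (hJ : J ∈ imagUnits) {z : ℂ} (hz : z ∈ D) :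
    slicePoint J z ∈ axialSet D := by
  simp only [axialSet, mem_iUnion, mem_image]
  exact ⟨J, hJ, z, hz, rfl⟩

theorem isOpen_axialSet {D : Set ℂ} (hD : ConjInvariant D) (hDo : IsOpen D) :
    IsOpen (axialSet D) := by
  have : axialSet D = toPlane ⁻¹' D := by ext x; exact mem_axialSet_iff hD
  rw [this]
  exact hDo.preimage continuous_toPlane

/-- Oddness at z = z̄. This makes the value `0` of `toUnit` at real points harmless. -/
theorem IsStemOn.snd_eq_zero {F : ℂ → ℍ × ℍ} {D : Set ℂ} (hF : IsStemOn F D) {z : ℂ} (hz : z ∈ D)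
    (h : z.im = 0) : (F z).2 = 0 := by
  have h1 := hF z hz
  have h2 : star z = z := Complex.conj_eq_iff_im.2 h
  rw [h2] at h1
  have h3 : (F z).2 = -(F z).2 := congrArg Prod.snd h1
  have h4 : (2 : ℝ) • (F z).2 = 0 := by
    rw [two_smul]
    nth_rewrite 1 [h3]
    exact neg_add_cancel _
  exact (smul_eq_zero.1 h4).resolve_left two_ne_zero

theorem IsStemOn.isInducedBy_sliceMap {F : ℂ → ℍ × ℍ} {D : Set ℂ} (hF : IsStemOn F D)
    (hD : ConjInvariant D) : IsInducedBy (sliceMap F) F D := by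
  refine slicePoint_nonneg_induction hD ?_ ?_
  · intro J _ z hz h
    rw [slicePoint_neg_star, h, hF z hz]
    simp [stemConj]
  · intro J hJ z hz h
    rw [sliceMap, toPlane_slicePoint_of_nonneg hJ h]
    rcases h.eq_or_lt with h | h
    · rw [hF.snd_eq_zero hz h.symm, mul_zero, mul_zero]
    · rw [toUnit_slicePoint_of_pos hJ h]

theorem IsInducedBy.eq_sliceMap {f : ℍ → ℍ} {F : ℂ → ℍ × ℍ} {D : Set ℂ} (hf : IsInducedBy f F D)
    (hF : IsStemOn F D) (hD : ConjInvariant D) : EqOn f (sliceMap F) (axialSet D) := by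
  intro x hx
  simp only [axialSet, mem_iUnion, mem_image] at hx
  obtain ⟨J, hJ, z, hz, rfl⟩ := hx
  rw [hf J hJ z hz, hF.isInducedBy_sliceMap hD J hJ z hz]

/-! ### Differential calculus of slice functions off the real axis -/

theorem hasFDerivAt_im (x : ℍ) : HasFDerivAt (fun y : ℍ => y.im) imL x := by
  simp_rw [← imL_apply]
  exact imL.hasFDerivAt

theorem hasFDerivAt_norm_im {x : ℍ} (hx : x.im ≠ 0) :
    HasFDerivAt (fun y : ℍ => ‖y.im‖) ((innerSL ℝ (toUnit x)).comp imL) x := by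
  have h0 : ‖x.im‖ ≠ 0 := norm_ne_zero_iff.2 hx
  have h1 := hasFDerivAt_im x
  have h2 := (h1.norm_sq).sqrt (pow_ne_zero 2 h0)
  simp only [Real.sqrt_sq (norm_nonneg _)] at h2
  refine h2.congr_fderiv ?_
  ext v
  simp [toUnit]
  field_simp

/-- The differential of `toPlane` at `x`, when `J` is the imaginary unit of `x`. -/
def toPlaneDeriv (J : ℍ) : ℍ →L[ℝ] ℂ :=
  reL.smulRight (1 : ℂ) + ((innerSL ℝ J).comp imL).smulRight Complex.I

theorem hasFDerivAt_toPlane {x : ℍ} (hx : x.im ≠ 0) :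
    HasFDerivAt toPlane (toPlaneDeriv (toUnit x)) x := by
  have h := ((reL.hasFDerivAt (x := x)).smul_const (1 : ℂ)).add
    ((hasFDerivAt_norm_im hx).smul_const Complex.I)
  refine h.congr_of_eventuallyEq (Eventually.of_forall fun y => ?_)
  apply Complex.ext <;> simp [toPlane]

theorem hasFDerivAt_toUnit {x : ℍ} (hx : x.im ≠ 0) :
    HasFDerivAt toUnit (‖x.im‖⁻¹ • (imL - ((innerSL ℝ (toUnit x)).comp imL).smulRight
      (toUnit x))) x := by
  have h0 : ‖x.im‖ ≠ 0 := norm_ne_zero_iff.2 hx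
  have h1 := hasFDerivAt_im x
  have h2 := ((hasDerivAt_inv h0).comp_hasFDerivAt x (hasFDerivAt_norm_im hx)).smul h1
  refine h2.congr_fderiv ?_
  ext1 v
  simp only [toUnit, Function.comp_apply, add_apply, smul_apply,
    ContinuousLinearMap.smulRight_apply, sub_apply,
    ContinuousLinearMap.comp_apply, imL_apply, innerSL_apply_apply]
  module

/-- Differentiability of a slice function off the real axis, with the values of its differential. -/
theorem differentiableAt_sliceMap_and_fderiv_apply {F : ℂ → ℍ × ℍ} {x : ℍ} (hx : x.im ≠ 0)
    (hF : DifferentiableAt ℝ F (toPlane x)) :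
    DifferentiableAt ℝ (sliceMap F) x ∧ ∀ v, fderiv ℝ (sliceMap F) x v =
      (fderiv ℝ F (toPlane x) (toPlaneDeriv (toUnit x) v)).1
      + toUnit x * (fderiv ℝ F (toPlane x) (toPlaneDeriv (toUnit x) v)).2
      + ‖x.im‖⁻¹ • ((v.im - (inner ℝ (toUnit x) v.im) • toUnit x) * (F (toPlane x)).2) := by
  have h1 := hF.hasFDerivAt.comp x (hasFDerivAt_toPlane hx)
  have h2 := h1.fst.add ((hasFDerivAt_toUnit hx).mul' h1.snd)
  refine ⟨h2.differentiableAt, fun v => ?_⟩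
  have h3 : fderiv ℝ (sliceMap F) x = _ := h2.fderiv
  rw [h3]
  simp
  abel

/-! ### The Cauchy-Riemann-Fueter operator on slice functions -/

/-- The vector part `i ∂/∂x₁ + j ∂/∂x₂ + k ∂/∂x₃` of the Cauchy-Riemann-Fueter operator. -/
def diracOp (f : ℍ → ℍ) (x : ℍ) : ℍ :=
  unitI * fderiv ℝ f x unitI + unitJ * fderiv ℝ f x unitJ + unitK * fderiv ℝ f x unitK

/-- Twice the Cauchy-Riemann-Fueter operator. -/
def fueterOp (f : ℍ → ℍ) (x : ℍ) : ℍ := fderiv ℝ f x 1 + diracOp f x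

/-- Twice the conjugate of the Cauchy-Riemann-Fueter operator. -/
def conjFueterOp (f : ℍ → ℍ) (x : ℍ) : ℍ := fderiv ℝ f x 1 - diracOp f x

theorem cauchyRiemannFueter_eq (f : ℍ → ℍ) (x : ℍ) :
    cauchyRiemannFueter f x = (2⁻¹ : ℝ) • fueterOp f x := by
  rw [cauchyRiemannFueter, fueterOp, diracOp, add_assoc, add_assoc, ← add_assoc (unitI * _)]

theorem fderiv_sliceMap_one {F : ℂ → ℍ × ℍ} {x : ℍ} (hx : x.im ≠ 0)
    (hF : DifferentiableAt ℝ F (toPlane x)) :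
    fderiv ℝ (sliceMap F) x 1 =
      (fderiv ℝ F (toPlane x) 1).1 + toUnit x * (fderiv ℝ F (toPlane x) 1).2 := by
  rw [(differentiableAt_sliceMap_and_fderiv_apply hx hF).2]
  have : toPlaneDeriv (toUnit x) 1 = 1 := by simp [toPlaneDeriv]
  simp [this]

theorem fderiv_sliceMap_of_re_eq_zero {F : ℂ → ℍ × ℍ} {x : ℍ} (hx : x.im ≠ 0)
    (hF : DifferentiableAt ℝ F (toPlane x)) {v : ℍ} (hv : v.re = 0) :
    fderiv ℝ (sliceMap F) x v = (inner ℝ (toUnit x) v) •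
      ((fderiv ℝ F (toPlane x) Complex.I).1 + toUnit x * (fderiv ℝ F (toPlane x) Complex.I).2)
      + ‖x.im‖⁻¹ • ((v - (inner ℝ (toUnit x) v) • toUnit x) * (F (toPlane x)).2) := by
  rw [(differentiableAt_sliceMap_and_fderiv_apply hx hF).2]
  have h1 : v.im = v := by
    have := re_add_im v
    rw [hv] at this
    simpa using this
  have : toPlaneDeriv (toUnit x) v = (inner ℝ (toUnit x) v) • Complex.I := by
    simp [toPlaneDeriv, hv, h1]
  rw [this, map_smul, h1, Prod.smul_fst, Prod.smul_snd, mul_smul_comm, smul_add]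

/-- With e running over i, j, k, the radial part contributes Σ ⟨J, e⟩ e = J times the β-derivative.
The variation of J contributes β⁻¹ Σ e(e - ⟨J, e⟩J) F₂, where the sum is -3 - J² = -2. -/
theorem diracOp_sliceMap {F : ℂ → ℍ × ℍ} {x : ℍ} (hx : x.im ≠ 0)
    (hF : DifferentiableAt ℝ F (toPlane x)) :
    diracOp (sliceMap F) x = toUnit x *
      ((fderiv ℝ F (toPlane x) Complex.I).1 + toUnit x * (fderiv ℝ F (toPlane x) Complex.I).2)
      - (2 * ‖x.im‖⁻¹) • (F (toPlane x)).2 := by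
  rw [diracOp, fderiv_sliceMap_of_re_eq_zero hx hF unitI_re,
    fderiv_sliceMap_of_re_eq_zero hx hF unitJ_re, fderiv_sliceMap_of_re_eq_zero hx hF unitK_re]
  have hJ := mem_imagUnits_iff.1 (toUnit_mem_imagUnits hx)
  have hJ2 := mul_self_of_mem_imagUnits (toUnit_mem_imagUnits hx)
  set J := toUnit x
  generalize (fderiv ℝ F (toPlane x) Complex.I).1 + J * (fderiv ℝ F (toPlane x) Complex.I).2 = X
  generalize (F (toPlane x)).2 = Y
  generalize ‖x.im‖⁻¹ = b
  have hs : (inner ℝ J unitI) • unitI + (inner ℝ J unitJ) • unitJ + (inner ℝ J unitK) • unitK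
      = J := by
    ext <;> simp [inner_def, hJ.1]
  have hs' : unitI * (unitI - (inner ℝ J unitI) • J) + unitJ * (unitJ - (inner ℝ J unitJ) • J)
      + unitK * (unitK - (inner ℝ J unitK) • J) = (-2 : ℝ) • (1 : ℍ) := by
    have h3 : unitI * unitI + unitJ * unitJ + unitK * unitK = (-3 : ℝ) • (1 : ℍ) := by
      ext <;> norm_num
    calc _ = unitI * unitI + unitJ * unitJ + unitK * unitK - ((inner ℝ J unitI) • unitI
          + (inner ℝ J unitJ) • unitJ + (inner ℝ J unitK) • unitK) * J := by
          simp only [mul_sub, add_mul, smul_mul_assoc, mul_smul_comm]; abel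
      _ = _ := by rw [hs, h3, hJ2]; module
  calc _ = ((inner ℝ J unitI) • unitI + (inner ℝ J unitJ) • unitJ + (inner ℝ J unitK) • unitK) * X
        + b • ((unitI * (unitI - (inner ℝ J unitI) • J) + unitJ * (unitJ - (inner ℝ J unitJ) • J)
        + unitK * (unitK - (inner ℝ J unitK) • J)) * Y) := by
        simp only [mul_add, add_mul, smul_mul_assoc, mul_smul_comm, smul_add, mul_assoc]; abel
    _ = _ := by
        rw [hs, hs', smul_mul_assoc, one_mul, smul_smul, sub_eq_add_neg, ← neg_smul]
        congr 2
        ring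

theorem fueterOp_sliceMap {F : ℂ → ℍ × ℍ} {x : ℍ} (hx : x.im ≠ 0)
    (hF : DifferentiableAt ℝ F (toPlane x)) :
    fueterOp (sliceMap F) x = ((fderiv ℝ F (toPlane x) 1).1 - (fderiv ℝ F (toPlane x) Complex.I).2
      - (2 * ‖x.im‖⁻¹) • (F (toPlane x)).2) + toUnit x *
      ((fderiv ℝ F (toPlane x) 1).2 + (fderiv ℝ F (toPlane x) Complex.I).1) := by
  rw [fueterOp, fderiv_sliceMap_one hx hF, diracOp_sliceMap hx hF, mul_add, ← mul_assoc,
    mul_self_of_mem_imagUnits (toUnit_mem_imagUnits hx)]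
  noncomm_ring

theorem conjFueterOp_sliceMap {F : ℂ → ℍ × ℍ} {x : ℍ} (hx : x.im ≠ 0)
    (hF : DifferentiableAt ℝ F (toPlane x)) :
    conjFueterOp (sliceMap F) x =
      ((fderiv ℝ F (toPlane x) 1).1 + (fderiv ℝ F (toPlane x) Complex.I).2
      + (2 * ‖x.im‖⁻¹) • (F (toPlane x)).2) + toUnit x *
      ((fderiv ℝ F (toPlane x) 1).2 - (fderiv ℝ F (toPlane x) Complex.I).1) := by
  rw [conjFueterOp, fderiv_sliceMap_one hx hF, diracOp_sliceMap hx hF, mul_add, ← mul_assoc,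
    mul_self_of_mem_imagUnits (toUnit_mem_imagUnits hx)]
  noncomm_ring

theorem contDiffAt_sliceMap {F : ℂ → ℍ × ℍ} {n : WithTop ℕ∞} {x : ℍ} (hx : x.im ≠ 0)
    (hF : ContDiffAt ℝ n F (toPlane x)) : ContDiffAt ℝ n (sliceMap F) x := by
  have him : ContDiff ℝ n (fun y : ℍ => y.im) := by
    simp_rw [← imL_apply]; exact imL.contDiff
  have hnorm : ContDiffAt ℝ n (fun y : ℍ => ‖y.im‖) x := him.contDiffAt.norm ℝ hx
  have hre : ContDiff ℝ n (fun y : ℍ => y.re) := by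
    simp_rw [← reL_apply]; exact reL.contDiff
  have hP : ContDiffAt ℝ n toPlane x := by
    have : toPlane = fun x => Complex.equivRealProdCLM.symm (x.re, ‖x.im‖) := by
      ext1 x
      apply Complex.ext <;> simp [toPlane]
    rw [this]
    exact Complex.equivRealProdCLM.symm.contDiff.contDiffAt.comp x (hre.contDiffAt.prodMk hnorm)
  have hU : ContDiffAt ℝ n toUnit x := (hnorm.inv (norm_ne_zero_iff.2 hx)).smul him.contDiffAt
  have hFP := hF.comp x hP
  exact hFP.fst.add (hU.mul hFP.snd)

/-! ### Factorization of the Laplacian -/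

/-- The orthonormal basis `1, i, j, k` of `ℍ`. -/
def basisH : OrthonormalBasis (Fin 4) ℝ ℍ := OrthonormalBasis.ofRepr linearIsometryEquivTuple

theorem laplacian_eq_sum (f : ℍ → ℍ) (x : ℍ) :
    Laplacian.laplacian f x = iteratedFDeriv ℝ 2 f x ![1, 1]
      + iteratedFDeriv ℝ 2 f x ![unitI, unitI]
      + iteratedFDeriv ℝ 2 f x ![unitJ, unitJ] + iteratedFDeriv ℝ 2 f x ![unitK, unitK] := by
  have h0 : basisH 0 = 1 := by ext <;> simp [basisH]
  have h1 : basisH 1 = unitI := by ext <;> simp [basisH]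
  have h2 : basisH 2 = unitJ := by ext <;> simp [basisH]
  have h3 : basisH 3 = unitK := by ext <;> simp [basisH]
  rw [InnerProductSpace.laplacian_eq_iteratedFDeriv_orthonormalBasis f basisH]
  simp only [Fin.sum_univ_four, h0, h1, h2, h3]

theorem fderiv_fueterOp_apply {f : ℍ → ℍ} {x : ℍ} (hf : ContDiffAt ℝ 2 f x) (v : ℍ) :
    fderiv ℝ (fueterOp f) x v = fderiv ℝ (fderiv ℝ f) x v 1
      + (unitI * fderiv ℝ (fderiv ℝ f) x v unitI + unitJ * fderiv ℝ (fderiv ℝ f) x v unitJ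
      + unitK * fderiv ℝ (fderiv ℝ f) x v unitK) := by
  have hd : DifferentiableAt ℝ (fderiv ℝ f) x :=
    (hf.fderiv_right (m := 1) (by norm_num)).differentiableAt one_ne_zero
  have h1 : ∀ w, HasFDerivAt (fun y => fderiv ℝ f y w)
      ((fderiv ℝ (fderiv ℝ f) x).flip w) x := fun w => by
    simpa using! hd.hasFDerivAt.clm_apply (hasFDerivAt_const w x)
  have h2 := (h1 1).add ((((h1 unitI).const_mul unitI).add ((h1 unitJ).const_mul unitJ)).add
    ((h1 unitK).const_mul unitK))
  have h3 : fderiv ℝ (fueterOp f) x = _ := h2.fderiv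
  rw [h3]
  simp

theorem contDiffAt_fueterOp {f : ℍ → ℍ} {x : ℍ} {n m : WithTop ℕ∞} (hf : ContDiffAt ℝ n f x)
    (hmn : m + 1 ≤ n) : ContDiffAt ℝ m (fueterOp f) x := by
  have h1 : ∀ w, ContDiffAt ℝ m (fun y => fderiv ℝ f y w) x := fun w =>
    (hf.fderiv_right hmn).clm_apply contDiffAt_const
  exact (h1 1).add (((contDiffAt_const.mul (h1 unitI)).add (contDiffAt_const.mul (h1 unitJ))).add
    (contDiffAt_const.mul (h1 unitK)))

theorem contDiffAt_conjFueterOp {f : ℍ → ℍ} {x : ℍ} {n m : WithTop ℕ∞} (hf : ContDiffAt ℝ n f x)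
    (hmn : m + 1 ≤ n) : ContDiffAt ℝ m (conjFueterOp f) x := by
  have h1 : ∀ w, ContDiffAt ℝ m (fun y => fderiv ℝ f y w) x := fun w =>
    (hf.fderiv_right hmn).clm_apply contDiffAt_const
  exact (h1 1).sub (((contDiffAt_const.mul (h1 unitI)).add (contDiffAt_const.mul (h1 unitJ))).add
    (contDiffAt_const.mul (h1 unitK)))

/-- The factorization `Δ = 4 ∂ ∂̄` of the Laplacian. -/
theorem laplacian_eq_conjFueterOp_fueterOp {f : ℍ → ℍ} {x : ℍ} (hf : ContDiffAt ℝ 2 f x) :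
    Laplacian.laplacian f x = conjFueterOp (fueterOp f) x := by
  have hsymm : IsSymmSndFDerivAt ℝ f x := hf.isSymmSndFDerivAt (by simp)
  simp only [laplacian_eq_sum, iteratedFDeriv_two_apply, conjFueterOp, diracOp,
    fderiv_fueterOp_apply hf]
  simp only [Matrix.cons_val_zero, Matrix.cons_val_one]
  -- Mixed derivatives are put in one order; they then cancel, since i, j, k anticommute and the two
  -- operators carry opposite signs.
  rw [hsymm.eq unitI 1, hsymm.eq unitJ 1, hsymm.eq unitK 1, hsymm.eq unitJ unitI,
    hsymm.eq unitK unitI, hsymm.eq unitK unitJ]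
  generalize fderiv ℝ (fderiv ℝ f) x = H
  have hII : unitI * unitI = -1 := by ext <;> simp
  have hJJ : unitJ * unitJ = -1 := by ext <;> simp
  have hKK : unitK * unitK = -1 := by ext <;> simp
  have hIJ : unitI * unitJ = unitK := by ext <;> simp
  have hJI : unitJ * unitI = -unitK := by ext <;> simp
  have hJK : unitJ * unitK = unitI := by ext <;> simp
  have hKJ : unitK * unitJ = -unitI := by ext <;> simp
  have hKI : unitK * unitI = unitJ := by ext <;> simp
  have hIK : unitI * unitK = -unitJ := by ext <;> simp
  simp only [mul_add, ← mul_assoc, hII, hJJ, hKK, hIJ, hJI, hJK, hKJ, hKI, hIK, neg_mul, one_mul]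
  abel

theorem fueterOp_congr {f g : ℍ → ℍ} {x : ℍ} (h : f =ᶠ[𝓝 x] g) :
    fueterOp f x = fueterOp g x := by
  simp only [fueterOp, diracOp, h.fderiv_eq]

theorem conjFueterOp_congr {f g : ℍ → ℍ} {x : ℍ} (h : f =ᶠ[𝓝 x] g) :
    conjFueterOp f x = conjFueterOp g x := by
  simp only [conjFueterOp, diracOp, h.fderiv_eq]

/-! ### Smoothness of slice regular functions across the real axis -/

/-- The complex function with the `i`-th coordinates of the two components of `F` as its real and
imaginary parts. -/
def stemCoord (F : ℂ → ℍ × ℍ) (i : Fin 4) (z : ℂ) : ℂ :=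
  ⟨inner ℝ (basisH i) (F z).1, inner ℝ (basisH i) (F z).2⟩

/-- The stem function with real components given by a complex function. -/
def realStem (φ : ℂ → ℂ) (z : ℂ) : ℍ × ℍ := (((φ z).re : ℍ), ((φ z).im : ℍ))

theorem eq_sum_stemCoord (F : ℂ → ℍ × ℍ) (z : ℂ) :
    F z = ∑ i, ((stemCoord F i z).re • basisH i, (stemCoord F i z).im • basisH i) := by
  ext1
  · rw [Prod.fst_sum]; exact (basisH.sum_repr' _).symm
  · rw [Prod.snd_sum]; exact (basisH.sum_repr' _).symm

/-- J multiplies on the left, so constants on the right factor out. This reduces regularity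
questions to four complex-valued functions. -/
theorem sliceMap_eq_sum (F : ℂ → ℍ × ℍ) (x : ℍ) :
    sliceMap F x = ∑ i, sliceMap (realStem (stemCoord F i)) x * basisH i := by
  rw [sliceMap, eq_sum_stemCoord F, Prod.fst_sum, Prod.snd_sum, Finset.mul_sum,
    ← Finset.sum_add_distrib]
  refine Finset.sum_congr rfl fun i _ => ?_
  simp only [sliceMap, realStem, add_mul, mul_assoc, coe_mul_eq_smul]

theorem IsHolomorphicStemOn.differentiableAt_stemCoord {F : ℂ → ℍ × ℍ} {D : Set ℂ}
    (hF : IsHolomorphicStemOn F D) (i : Fin 4) {z : ℂ} (hz : z ∈ D) :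
    DifferentiableAt ℂ (stemCoord F i) z := by
  obtain ⟨hd, hI⟩ := hF z hz
  have h1 := ((innerSL ℝ (basisH i)).hasFDerivAt.comp z hd.hasFDerivAt.fst)
  have h2 := ((innerSL ℝ (basisH i)).hasFDerivAt.comp z hd.hasFDerivAt.snd)
  have h3 := Complex.equivRealProdCLM.symm.hasFDerivAt.comp z (h1.prodMk h2)
  have h4 : HasFDerivAt (stemCoord F i) _ z := h3.congr_of_eventuallyEq
    (Eventually.of_forall fun w => by apply Complex.ext <;> simp [stemCoord])
  rw [differentiableAt_complex_iff_differentiableAt_real]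
  refine ⟨h4.differentiableAt, ?_⟩
  rw [h4.fderiv]
  have h5 := hI 1
  rw [mul_one] at h5
  apply Complex.ext <;> simp [h5, stemMulI]

theorem IsHolomorphicStemOn.contDiffAt {F : ℂ → ℍ × ℍ} {D : Set ℂ} (hD : IsOpen D)
    (hF : IsHolomorphicStemOn F D) {z : ℂ} (hz : z ∈ D) {n : WithTop ℕ∞} : ContDiffAt ℝ n F z := by
  have h1 : ∀ i, ContDiffAt ℝ n (stemCoord F i) z := fun i => by
    have : DifferentiableOn ℂ (stemCoord F i) D := fun w hw =>
      (hF.differentiableAt_stemCoord i hw).differentiableWithinAt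
    exact ((this.contDiffOn hD).contDiffAt (hD.mem_nhds hz)).restrict_scalars ℝ
  have h2 : F = fun z => ∑ i, ((stemCoord F i z).re • basisH i, (stemCoord F i z).im • basisH i) :=
    funext (eq_sum_stemCoord F)
  rw [h2]
  refine ContDiffAt.sum fun i _ => ?_
  have h3 := Complex.reCLM.contDiff.contDiffAt.comp z (h1 i)
  have h4 := Complex.imCLM.contDiff.contDiffAt.comp z (h1 i)
  exact (h3.smul contDiffAt_const).prodMk (h4.smul contDiffAt_const)

theorem slicePoint_eq_liftAux {J : ℍ} (hJ : J ∈ imagUnits) (z : ℂ) :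
    slicePoint J z = Complex.liftAux J (mul_self_of_mem_imagUnits hJ) z := by
  rw [Complex.liftAux_apply, slicePoint, mul_coe_eq_smul]
  rfl

theorem continuous_slicePoint (J : ℍ) : Continuous (slicePoint J) := by
  unfold slicePoint
  exact (continuous_coe.comp Complex.continuous_re).add
    (continuous_const.mul (continuous_coe.comp Complex.continuous_im))

/-- At a real point J is arbitrary, and the symmetry of φ makes its value real there, so the choice
does not matter. -/
theorem sliceMap_realStem {φ : ℂ → ℂ} {J x : ℍ} (hx : x.im = ‖x.im‖ • J)
    (hφ : φ (star (toPlane x)) = star (φ (toPlane x))) :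
    sliceMap (realStem φ) x = slicePoint J (φ (toPlane x)) := by
  rw [sliceMap, slicePoint, realStem]
  by_cases h : x.im = 0
  · have h1 : star (toPlane x) = toPlane x := Complex.conj_eq_iff_im.2 (by simp [toPlane, h])
    rw [h1] at hφ
    have h2 : (φ (toPlane x)).im = 0 := Complex.conj_eq_iff_im.1 hφ.symm
    simp [h2]
  · have : toUnit x = J := by
      rw [toUnit]
      nth_rewrite 2 [hx]
      rw [smul_smul, inv_mul_cancel₀ (norm_ne_zero_iff.2 h), one_smul]
    rw [this]

/-- A holomorphic function commuting with the conjugation has a power series with real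
coefficients at every real point. -/
theorem exists_real_hasSum {φ : ℂ → ℂ} {c r : ℝ}
    (hφ : DifferentiableOn ℂ φ (Metric.ball (c : ℂ) r))
    (hs : ∀ z ∈ Metric.ball (c : ℂ) r, φ (star z) = star (φ z)) :
    ∃ a : ℕ → ℝ, ∀ z ∈ Metric.ball (c : ℂ) r,
      HasSum (fun n => (a n) • (z - c) ^ n) (φ z) := by
  refine ⟨fun n => ((n.factorial : ℂ)⁻¹ * iteratedDeriv n φ c).re, fun z hz => ?_⟩
  set b : ℕ → ℂ := fun n => (n.factorial : ℂ)⁻¹ * iteratedDeriv n φ c with hb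
  have hz' : star z ∈ Metric.ball (c : ℂ) r := by
    rw [mem_ball_iff_norm] at hz ⊢
    rw [← _root_.norm_star (z - c), star_sub] at hz
    simpa using hz
  have h1 := Complex.hasSum_taylorSeries_on_ball hφ hz
  have h2 := (Complex.hasSum_taylorSeries_on_ball hφ hz').star
  rw [hs z hz, star_star] at h2
  -- Averaging the series at z with the conjugate of the series at z̄ replaces each coefficient by
  -- its real part.
  have h3 := (h1.add h2).mul_left (2⁻¹ : ℂ)
  have h4 : (2⁻¹ : ℂ) * (φ z + φ z) = φ z := by ring
  rw [h4] at h3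
  convert! h3 using 2 with n
  have h5 : ((b n).re : ℂ) = 2⁻¹ * (b n + star (b n)) := by
    rw [show star (b n) = (starRingEnd ℂ) (b n) from rfl, Complex.add_conj]
    push_cast
    ring
  have h6 : star (z - c) = star z - c := by simp
  change ((b n).re : ℝ) • (z - c) ^ n = _
  rw [Complex.real_smul, h5]
  simp only [smul_eq_mul, star_mul, star_inv₀, star_pow, hb, ← h6, star_star, star_natCast]
  ring

theorem norm_slicePoint {J : ℍ} (hJ : J ∈ imagUnits) (z : ℂ) : ‖slicePoint J z‖ = ‖z‖ := by
  have h : ‖slicePoint J z‖ ^ 2 = ‖z‖ ^ 2 := by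
    have h1 := mem_imagUnits_iff.1 hJ
    have h2 : normSq J = 1 := by rw [normSq_eq_norm_mul_self, h1.2, one_mul]
    rw [normSq_def', h1.1] at h2
    rw [sq, ← normSq_eq_norm_mul_self, normSq_def', ← Complex.normSq_eq_norm_sq,
      Complex.normSq_apply]
    simp [slicePoint, h1.1]
    linear_combination z.im ^ 2 * h2
  exact (sq_eq_sq₀ (norm_nonneg _) (norm_nonneg _)).1 h

/-- The algebra map ℂ → ℍ with i ↦ J carries Σ aₙ(z - c)ⁿ to Σ aₙyⁿ for y in the plane of J. The
coefficients are real, hence independent of J, so one quaternionic power series serves all planes.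
-/
theorem analyticAt_sliceMap_realStem {φ : ℂ → ℂ} {c r : ℝ} (hr : 0 < r)
    (hφ : DifferentiableOn ℂ φ (Metric.ball (c : ℂ) r))
    (hs : ∀ z ∈ Metric.ball (c : ℂ) r, φ (star z) = star (φ z)) :
    AnalyticAt ℝ (sliceMap (realStem φ)) (c : ℍ) := by
  obtain ⟨a, ha⟩ := exists_real_hasSum hφ hs
  refine ⟨FormalMultilinearSeries.ofScalars ℍ a, ENNReal.ofReal r, ?_, by simpa using hr, ?_⟩
  · refine ENNReal.le_of_forall_nnreal_lt fun s hsr => ?_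
    have hsr' : (s : ℝ) < r := by
      rwa [← ENNReal.ofReal_coe_nnreal, ENNReal.ofReal_lt_ofReal_iff hr] at hsr
    -- Convergence at the real point c + s gives aₙsⁿ → 0, which bounds the radius from below by s.
    have h1 : ((c + s : ℝ) : ℂ) ∈ Metric.ball (c : ℂ) r := by
      simpa [mem_ball_iff_norm] using hsr'
    refine FormalMultilinearSeries.le_radius_of_tendsto (l := 0) _ ?_
    have h2 := (ha _ h1).summable.tendsto_atTop_zero.norm
    simpa using! h2
  · intro y hy
    have hy' : ‖y‖ < r := by
      rw [Metric.mem_eball, edist_zero_right, ← ofReal_norm, ENNReal.ofReal_lt_ofReal_iff hr] at hy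
      exact hy
    obtain ⟨J, hJ, hJy⟩ := exists_mem_imagUnits_im_eq y
    have h1 : slicePoint J (toPlane y) = y := slicePoint_toPlane hJy
    have h2 : toPlane (c + y) = c + toPlane y := by apply Complex.ext <;> simp [toPlane]
    have h3 : toPlane (c + y) ∈ Metric.ball (c : ℂ) r := by
      rw [h2, mem_ball_iff_norm, add_sub_cancel_left, ← norm_slicePoint hJ, h1]
      exact hy'
    rw [sliceMap_realStem (by simpa using hJy) (hs _ h3), slicePoint_eq_liftAux hJ]
    have h4 := (ha _ h3).map (Complex.liftAux J (mul_self_of_mem_imagUnits hJ)) (by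
      have : ⇑(Complex.liftAux J (mul_self_of_mem_imagUnits hJ)) = slicePoint J :=
        funext fun z => (slicePoint_eq_liftAux hJ z).symm
      rw [this]; exact continuous_slicePoint J)
    convert! h4 using 2 with n
    rw [Function.comp_apply, map_smul, map_pow, h2, add_sub_cancel_left, ← slicePoint_eq_liftAux hJ,
      h1]
    exact FormalMultilinearSeries.ofScalars_apply_eq a y n

theorem isOpen_im_ne_zero : IsOpen {x : ℍ | x.im ≠ 0} :=
  isOpen_ne.preimage continuous_im

theorem toPlane_im_ne_zero {x : ℍ} (hx : x.im ≠ 0) : (toPlane x).im ≠ 0 :=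
  norm_ne_zero_iff.2 hx

/-- Every point of an axially symmetric open set is a limit of nonreal points of this set. -/
theorem eq_of_eqOn_im_ne_zero {D : Set ℂ} (hD : ConjInvariant D) (hDo : IsOpen D) {f g : ℍ → ℍ}
    (hf : ContinuousOn f (axialSet D)) (hg : ContinuousOn g (axialSet D))
    (h : ∀ x ∈ axialSet D, x.im ≠ 0 → f x = g x) : EqOn f g (axialSet D) := by
  intro x hx
  by_cases hxi : x.im = 0
  · have hΩ := (isOpen_axialSet hD hDo).mem_nhds hx
    have hc : Tendsto (fun t : ℝ => x + t • unitI) (𝓝[≠] 0) (𝓝 x) := by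
      have : Tendsto (fun t : ℝ => x + t • unitI) (𝓝 0) (𝓝 (x + (0 : ℝ) • unitI)) :=
        Continuous.tendsto (by fun_prop) 0
      rw [zero_smul, add_zero] at this
      exact this.mono_left nhdsWithin_le_nhds
    refine tendsto_nhds_unique (((hf.continuousAt hΩ).tendsto.comp hc))
      (((hg.continuousAt hΩ).tendsto.comp hc).congr' ?_)
    -- A real point moved by t·i with t ≠ 0 is no longer real.
    filter_upwards [hc.eventually hΩ, self_mem_nhdsWithin] with t ht ht0
    refine (h _ ht fun h0 => ht0 ?_).symm
    have h1 : x.imI + t = 0 := by simpa using! congrArg QuaternionAlgebra.imI h0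
    have h2 : x.imI = 0 := by simpa using! congrArg QuaternionAlgebra.imI hxi
    rwa [h2, zero_add] at h1
  · exact h x hx hxi

theorem IsStemOn.stemCoord_star {F : ℂ → ℍ × ℍ} {D : Set ℂ} (hF : IsStemOn F D) (i : Fin 4) {z : ℂ}
    (hz : z ∈ D) : stemCoord F i (star z) = star (stemCoord F i z) := by
  rw [stemCoord, hF z hz]
  apply Complex.ext <;> simp [stemCoord, stemConj]

/-! ### Fueter's theorem: the Laplacian of a slice regular function -/

section Regular

variable {D : Set ℂ} {F : ℂ → ℍ × ℍ} {f : ℍ → ℍ}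

/-- Slice regular functions are smooth, also across the real axis. -/
theorem contDiffAt_of_regular (hDo : IsOpen D) (hD : ConjInvariant D) (hF : IsStemOn F D)
    (hh : IsHolomorphicStemOn F D) (hf : IsInducedBy f F D) {x : ℍ} (hx : x ∈ axialSet D)
    (n : WithTop ℕ∞) : ContDiffAt ℝ n f x := by
  have hev : f =ᶠ[𝓝 x] sliceMap F := by
    filter_upwards [(isOpen_axialSet hD hDo).mem_nhds hx] with y hy using hf.eq_sliceMap hF hD hy
  refine ContDiffAt.congr_of_eventuallyEq ?_ hev
  have hz := (mem_axialSet_iff hD).1 hx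
  -- At real points `toUnit` is discontinuous, so smoothness comes from the power series of the four
  -- coordinates; elsewhere composition suffices.
  by_cases hxi : x.im = 0
  · have hxr : x = (x.re : ℍ) := by
      have := re_add_im x
      rw [hxi, add_zero] at this
      exact this.symm
    have hp : toPlane x = (x.re : ℂ) := by apply Complex.ext <;> simp [toPlane, hxi]
    rw [hp] at hz
    obtain ⟨r, hr, hrD⟩ := Metric.isOpen_iff.1 hDo _ hz
    have h1 : sliceMap F = fun y => ∑ i, sliceMap (realStem (stemCoord F i)) y * basisH i :=
      funext (sliceMap_eq_sum F)
    rw [h1]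
    refine ContDiffAt.sum fun i _ => ContDiffAt.mul ?_ contDiffAt_const
    rw [hxr]
    exact (analyticAt_sliceMap_realStem hr
      (fun w hw => (hh.differentiableAt_stemCoord i (hrD hw)).differentiableWithinAt)
      (fun w hw => hF.stemCoord_star i (hrD hw))).contDiffAt
  · exact contDiffAt_sliceMap hxi (hh.contDiffAt hDo hz)

/-- The spherical derivative `F₂ / β` of a stem function. -/
def sphericalDeriv (F : ℂ → ℍ × ℍ) (z : ℂ) : ℍ := z.im⁻¹ • (F z).2

/-- The stem function of the Laplacian of a slice regular function with spherical derivative `h`. -/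
def laplacianStem (h : ℂ → ℍ) (z : ℂ) : ℍ × ℍ :=
  ((-2 : ℝ) • fderiv ℝ h z 1, (2 : ℝ) • fderiv ℝ h z Complex.I)

theorem contDiffAt_sphericalDeriv {n : WithTop ℕ∞} {z : ℂ} (hz : z.im ≠ 0)
    (hF : ContDiffAt ℝ n F z) : ContDiffAt ℝ n (sphericalDeriv F) z :=
  (Complex.imCLM.contDiff.contDiffAt.inv hz).smul hF.snd

theorem IsHolomorphicStemOn.fderiv_I (hh : IsHolomorphicStemOn F D) {z : ℂ} (hz : z ∈ D) :
    (fderiv ℝ F z Complex.I).1 = -(fderiv ℝ F z 1).2 ∧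
      (fderiv ℝ F z Complex.I).2 = (fderiv ℝ F z 1).1 := by
  have h := (hh z hz).2 1
  rw [mul_one] at h
  rw [h]
  exact ⟨rfl, rfl⟩

theorem eventually_nonreal (hDo : IsOpen D) (hD : ConjInvariant D) {x : ℍ}
    (hx : x ∈ axialSet D) (hxi : x.im ≠ 0) : ∀ᶠ y in 𝓝 x, y ∈ axialSet D ∧ y.im ≠ 0 :=
  ((isOpen_axialSet hD hDo).inter isOpen_im_ne_zero).mem_nhds ⟨hx, hxi⟩

/-- The Cauchy-Riemann equations cancel every first-order term and leave -2F₂/β, which has no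
J-part. -/
theorem fueterOp_of_regular (hDo : IsOpen D) (hD : ConjInvariant D) (hF : IsStemOn F D)
    (hh : IsHolomorphicStemOn F D) (hf : IsInducedBy f F D) {x : ℍ} (hx : x ∈ axialSet D)
    (hxi : x.im ≠ 0) :
    fueterOp f x = sliceMap (fun z => ((-2 : ℝ) • sphericalDeriv F z, 0)) x := by
  have hev : f =ᶠ[𝓝 x] sliceMap F := by
    filter_upwards [(isOpen_axialSet hD hDo).mem_nhds hx] with y hy using hf.eq_sliceMap hF hD hy
  have hz := (mem_axialSet_iff hD).1 hx
  obtain ⟨h1, h2⟩ := hh.fderiv_I hz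
  rw [fueterOp_congr hev, fueterOp_sliceMap hxi (hh _ hz).1, h1, h2, sliceMap]
  have h3 : (toPlane x).im = ‖x.im‖ := rfl
  simp only [sphericalDeriv, h3]
  rw [sub_self, zero_sub, add_neg_cancel, mul_zero, smul_smul, neg_mul, neg_smul]

theorem laplacian_of_regular (hDo : IsOpen D) (hD : ConjInvariant D) (hF : IsStemOn F D)
    (hh : IsHolomorphicStemOn F D) (hf : IsInducedBy f F D) {x : ℍ} (hx : x ∈ axialSet D)
    (hxi : x.im ≠ 0) :
    Laplacian.laplacian f x = sliceMap (laplacianStem (sphericalDeriv F)) x := by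
  have hz := (mem_axialSet_iff hD).1 hx
  have hev : fueterOp f =ᶠ[𝓝 x] sliceMap (fun z => ((-2 : ℝ) • sphericalDeriv F z, 0)) := by
    filter_upwards [eventually_nonreal hDo hD hx hxi] with y hy
    exact fueterOp_of_regular hDo hD hF hh hf hy.1 hy.2
  have hs : DifferentiableAt ℝ (sphericalDeriv F) (toPlane x) :=
    (contDiffAt_sphericalDeriv (n := 1) (toPlane_im_ne_zero hxi)
      (hh.contDiffAt hDo hz)).differentiableAt one_ne_zero
  have hs' : HasFDerivAt (fun z => ((-2 : ℝ) • sphericalDeriv F z, (0 : ℍ))) _ (toPlane x) :=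
    (hs.hasFDerivAt.const_smul (-2 : ℝ)).prodMk (hasFDerivAt_const (0 : ℍ) (toPlane x))
  rw [laplacian_eq_conjFueterOp_fueterOp (contDiffAt_of_regular hDo hD hF hh hf hx 2),
    conjFueterOp_congr hev, conjFueterOp_sliceMap hxi hs'.differentiableAt, hs'.fderiv,
    sliceMap]
  simp [laplacianStem]

theorem hasFDerivAt_fderiv_apply {V : Type*} [NormedAddCommGroup V] [NormedSpace ℝ V]
    {u : ℂ → V} {z : ℂ}
    (hu : ContDiffAt ℝ 2 u z) (v : ℂ) :
    HasFDerivAt (fun w => fderiv ℝ u w v) ((fderiv ℝ (fderiv ℝ u) z).flip v) z := by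
  have hd : DifferentiableAt ℝ (fderiv ℝ u) z :=
    (hu.fderiv_right (m := 1) (by norm_num)).differentiableAt one_ne_zero
  simpa using! hd.hasFDerivAt.clm_apply (hasFDerivAt_const v z)

/-- The second component of a holomorphic stem function is harmonic. -/
theorem IsHolomorphicStemOn.harmonic_snd (hDo : IsOpen D) (hh : IsHolomorphicStemOn F D) {z : ℂ}
    (hz : z ∈ D) :
    fderiv ℝ (fderiv ℝ fun w => (F w).2) z 1 1
      + fderiv ℝ (fderiv ℝ fun w => (F w).2) z Complex.I Complex.I = 0 := by
  have hF : ContDiffAt ℝ 2 F z := hh.contDiffAt hDo hz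
  have h1 : (fun w => fderiv ℝ (fun w => (F w).2) w 1) =ᶠ[𝓝 z]
      fun w => -fderiv ℝ (fun w => (F w).1) w Complex.I := by
    filter_upwards [hDo.mem_nhds hz] with w hw
    have hd := (hh w hw).1.hasFDerivAt
    rw [hd.fst.fderiv, hd.snd.fderiv]
    simp [(hh.fderiv_I hw).1]
  have h2 : (fun w => fderiv ℝ (fun w => (F w).2) w Complex.I) =ᶠ[𝓝 z]
      fun w => fderiv ℝ (fun w => (F w).1) w 1 := by
    filter_upwards [hDo.mem_nhds hz] with w hw
    have hd := (hh w hw).1.hasFDerivAt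
    rw [hd.fst.fderiv, hd.snd.fderiv]
    simp [(hh.fderiv_I hw).2]
  have e1 := (hasFDerivAt_fderiv_apply hF.snd 1).unique
    ((hasFDerivAt_fderiv_apply hF.fst Complex.I).neg.congr_of_eventuallyEq h1)
  have e2 := (hasFDerivAt_fderiv_apply hF.snd Complex.I).unique
    ((hasFDerivAt_fderiv_apply hF.fst 1).congr_of_eventuallyEq h2)
  have e3 := DFunLike.congr_fun e1 1
  have e4 := DFunLike.congr_fun e2 Complex.I
  simp only [ContinuousLinearMap.flip_apply, neg_apply] at e3 e4
  rw [e3, e4, (hF.fst.isSymmSndFDerivAt (by simp)).eq Complex.I 1, neg_add_cancel]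

/-- The equation satisfied by the spherical derivative of a holomorphic stem function. -/
theorem IsHolomorphicStemOn.sphericalDeriv_eq (hDo : IsOpen D) (hh : IsHolomorphicStemOn F D)
    {z : ℂ} (hz : z ∈ D) (hzi : z.im ≠ 0) :
    fderiv ℝ (fderiv ℝ (sphericalDeriv F)) z 1 1
      + fderiv ℝ (fderiv ℝ (sphericalDeriv F)) z Complex.I Complex.I
      + (2 * z.im⁻¹) • fderiv ℝ (sphericalDeriv F) z Complex.I = 0 := by
  have hF : ContDiffAt ℝ 2 F z := hh.contDiffAt hDo hz
  have hev : ∀ᶠ w in 𝓝 z, w ∈ D ∧ w.im ≠ 0 :=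
    (hDo.inter (isOpen_ne.preimage Complex.continuous_im)).mem_nhds ⟨hz, hzi⟩
  have h1 : ∀ v : ℂ, (fun w => fderiv ℝ (fun w => (F w).2) w v) =ᶠ[𝓝 z]
      fun w => w.im • fderiv ℝ (sphericalDeriv F) w v + v.im • sphericalDeriv F w := by
    intro v
    filter_upwards [hev.eventually_nhds] with w hw
    obtain ⟨hwD, hwi⟩ := hw.self_of_nhds
    have h2 : (fun w => (F w).2) =ᶠ[𝓝 w] fun w => w.im • sphericalDeriv F w := by
      filter_upwards [hw] with y hy
      rw [sphericalDeriv, smul_smul, mul_inv_cancel₀ hy.2, one_smul]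
    have hs : DifferentiableAt ℝ (sphericalDeriv F) w :=
      (contDiffAt_sphericalDeriv (n := 1) hwi (hh.contDiffAt hDo hwD)).differentiableAt one_ne_zero
    have h3 := (Complex.imCLM.hasFDerivAt (x := w)).smul hs.hasFDerivAt
    have h4 : fderiv ℝ (fun w => w.im • sphericalDeriv F w) w = _ := h3.fderiv
    rw [h2.fderiv_eq, h4]
    simp
  have hs2 := contDiffAt_sphericalDeriv hzi hF
  -- Leibniz rule for F₂ = βh, differentiated twice in the direction `v`.
  have key : ∀ v : ℂ, fderiv ℝ (fderiv ℝ fun w => (F w).2) z v v =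
      z.im • fderiv ℝ (fderiv ℝ (sphericalDeriv F)) z v v
      + (2 * v.im) • fderiv ℝ (sphericalDeriv F) z v := by
    intro v
    have h5 := ((Complex.imCLM.hasFDerivAt (x := z)).smul (hasFDerivAt_fderiv_apply hs2 v)).add
      ((hs2.differentiableAt two_ne_zero).hasFDerivAt.const_smul v.im)
    have h6 := DFunLike.congr_fun ((hasFDerivAt_fderiv_apply hF.snd v).unique
      (h5.congr_of_eventuallyEq (h1 v))) v
    simp only [ContinuousLinearMap.flip_apply] at h6
    rw [h6]
    simp
    module
  have h7 := hh.harmonic_snd hDo hz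
  rw [key, key] at h7
  have h8 : z.im • (fderiv ℝ (fderiv ℝ (sphericalDeriv F)) z 1 1
      + fderiv ℝ (fderiv ℝ (sphericalDeriv F)) z Complex.I Complex.I
      + (2 * z.im⁻¹) • fderiv ℝ (sphericalDeriv F) z Complex.I) = 0 := by
    rw [← h7]
    simp only [Complex.one_im, Complex.I_im, smul_add, smul_smul]
    rw [show z.im * (2 * z.im⁻¹) = 2 by field_simp]
    module
  exact (smul_eq_zero.1 h8).resolve_left hzi

/-- Fueter's theorem off the real axis. -/
theorem fueterOp_laplacian_of_regular (hDo : IsOpen D) (hD : ConjInvariant D) (hF : IsStemOn F D)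
    (hh : IsHolomorphicStemOn F D) (hf : IsInducedBy f F D) {x : ℍ} (hx : x ∈ axialSet D)
    (hxi : x.im ≠ 0) : fueterOp (Laplacian.laplacian f) x = 0 := by
  have hz := (mem_axialSet_iff hD).1 hx
  have hev : Laplacian.laplacian f =ᶠ[𝓝 x] sliceMap (laplacianStem (sphericalDeriv F)) := by
    filter_upwards [eventually_nonreal hDo hD hx hxi] with y hy
    exact laplacian_of_regular hDo hD hF hh hf hy.1 hy.2
  have hs2 : ContDiffAt ℝ 2 (sphericalDeriv F) (toPlane x) :=
    contDiffAt_sphericalDeriv (toPlane_im_ne_zero hxi) (hh.contDiffAt hDo hz)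
  have hs : HasFDerivAt (laplacianStem (sphericalDeriv F)) _ (toPlane x) :=
    ((hasFDerivAt_fderiv_apply hs2 1).const_smul (-2 : ℝ)).prodMk
      ((hasFDerivAt_fderiv_apply hs2 Complex.I).const_smul (2 : ℝ))
  rw [fueterOp_congr hev, fueterOp_sliceMap hxi hs.differentiableAt, hs.fderiv]
  have h1 := hh.sphericalDeriv_eq hDo hz (toPlane_im_ne_zero hxi)
  have h2 : (toPlane x).im = ‖x.im‖ := rfl
  have h3 := (hs2.isSymmSndFDerivAt (by simp)).eq Complex.I 1
  rw [h2] at h1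
  simp only [laplacianStem, ContinuousLinearMap.prod_apply, smul_apply,
    ContinuousLinearMap.flip_apply, h3]
  -- The J-part is a difference of equal mixed derivatives; the rest is -2 times the equation for h.
  rw [← add_smul, show (2 : ℝ) + -2 = 0 by norm_num, zero_smul, mul_zero, add_zero]
  refine Eq.trans ?_ ((congrArg (fun y => (-2 : ℝ) • y) h1).trans (smul_zero _))
  module

/-- The factorization, unlike the stem formula of `laplacian_of_regular`, is available at real
points too. -/
theorem contDiffAt_laplacian_of_regular (hDo : IsOpen D) (hD : ConjInvariant D) (hF : IsStemOn F D)
    (hh : IsHolomorphicStemOn F D) (hf : IsInducedBy f F D) {x : ℍ} (hx : x ∈ axialSet D) :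
    ContDiffAt ℝ 2 (Laplacian.laplacian f) x := by
  have h1 : Laplacian.laplacian f =ᶠ[𝓝 x] conjFueterOp (fueterOp f) := by
    filter_upwards [(isOpen_axialSet hD hDo).mem_nhds hx] with y hy
    exact laplacian_eq_conjFueterOp_fueterOp (contDiffAt_of_regular hDo hD hF hh hf hy 2)
  refine ContDiffAt.congr_of_eventuallyEq ?_ h1
  exact contDiffAt_conjFueterOp (n := 3) (contDiffAt_fueterOp (n := 4)
    (contDiffAt_of_regular hDo hD hF hh hf hx 4) (by norm_num)) (by norm_num)

theorem isMonogenicOn_laplacian_of_regular (hDo : IsOpen D) (hD : ConjInvariant D)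
    (hF : IsStemOn F D) (hh : IsHolomorphicStemOn F D) (hf : IsInducedBy f F D) :
    IsMonogenicOn (Laplacian.laplacian f) (axialSet D) := by
  have hc : ∀ x ∈ axialSet D, ContDiffAt ℝ 2 (Laplacian.laplacian f) x := fun x hx =>
    contDiffAt_laplacian_of_regular hDo hD hF hh hf hx
  have h0 : EqOn (fueterOp (Laplacian.laplacian f)) (fun _ => 0) (axialSet D) :=
    eq_of_eqOn_im_ne_zero hD hDo
      (fun x hx => (contDiffAt_fueterOp (m := 1) (hc x hx)
        (by norm_num)).continuousAt.continuousWithinAt) continuousOn_const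
      (fun x hx hxi => fueterOp_laplacian_of_regular hDo hD hF hh hf hx hxi)
  intro x hx
  refine ⟨(hc x hx).differentiableAt two_ne_zero, ?_⟩
  rw [cauchyRiemannFueter_eq, h0 hx, smul_zero]

end Regular

/-! ### Recovering a stem function from a slice function -/

theorem contDiff_slicePoint (J : ℍ) {n : WithTop ℕ∞} : ContDiff ℝ n (slicePoint J) := by
  have h : slicePoint J = fun z => z.re • (1 : ℍ) + z.im • J := by
    ext1 z
    rw [slicePoint, mul_coe_eq_smul]
    congr 1
    ext <;> simp
  rw [h]
  exact (Complex.reCLM.contDiff.smul contDiff_const).add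
    (Complex.imCLM.contDiff.smul contDiff_const)

/-- A `C¹` function that is a slice function off the real axis is induced by a `C¹` stem
function. -/
theorem mem_sliceC1_of_eq_sliceMap {D : Set ℂ} (hD : ConjInvariant D) {k : ℍ → ℍ}
    {G : ℂ → ℍ × ℍ} (hk : ∀ x ∈ axialSet D, ContDiffAt ℝ 1 k x)
    (hG : ∀ x ∈ axialSet D, x.im ≠ 0 → k x = sliceMap G x) : k ∈ sliceC1 D := by
  -- From p = G₁ + iG₂ and q = G₁ - iG₂ the stem function is ((p + q)/2, -i(p - q)/2). Built from
  -- `k` on a single plane, it is C¹ also at β = 0.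
  set p : ℂ → ℍ := fun z => k (slicePoint unitI z)
  set q : ℂ → ℍ := fun z => k (slicePoint (-unitI) z)
  have hI := unitI_mem_imagUnits
  have hps : ∀ z, p (star z) = q z := fun z => by
    simp only [p, q]
    rw [← slicePoint_neg_star unitI, star_star]
  have hqs : ∀ z, q (star z) = p z := fun z => by rw [← hps, star_star]
  have hstem : IsStemOn (fun z => ((2⁻¹ : ℝ) • (p z + q z),
      (2⁻¹ : ℝ) • (-unitI * (p z - q z)))) D := by
    intro z _
    simp only [hps, hqs, stemConj]
    ext1
    · simp only; rw [add_comm]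
    · simp only; rw [← smul_neg, ← mul_neg, neg_sub]
  refine ⟨_, hstem, ?_, ?_⟩
  · intro z hz
    refine ContDiffAt.contDiffWithinAt ?_
    have hp : ContDiffAt ℝ 1 p z := (hk _ (slicePoint_mem_axialSet hI hz)).comp z
      (contDiff_slicePoint _).contDiffAt
    have hq : ContDiffAt ℝ 1 q z :=
      (hk _ (slicePoint_mem_axialSet (neg_mem_imagUnits hI) hz)).comp z
      (contDiff_slicePoint _).contDiffAt
    exact ((hp.add hq).const_smul (2⁻¹ : ℝ)).prodMk
      ((contDiffAt_const.mul (hp.sub hq)).const_smul (2⁻¹ : ℝ))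
  · refine slicePoint_nonneg_induction hD ?_ ?_
    · intro J _ z hz h
      rw [slicePoint_neg_star, h, hstem z hz]
      simp [stemConj]
    · intro J hJ z hz h
      rcases h.eq_or_lt with h | h
      · have h1 : ∀ K : ℍ, slicePoint K z = z.re := fun K => by simp [slicePoint, ← h]
        simp only [p, q, h1, sub_self, mul_zero, smul_zero, add_zero]
        module
      · have h1 : ∀ K ∈ imagUnits, k (slicePoint K z) = (G z).1 + K * (G z).2 := by
          intro K hK
          rw [hG _ (slicePoint_mem_axialSet hK hz), sliceMap, toPlane_slicePoint_of_nonneg hK h.le,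
            toUnit_slicePoint_of_pos hK h]
          rw [im_slicePoint hK]
          have : ‖K‖ ≠ 0 := by rw [(mem_imagUnits_iff.1 hK).2]; exact one_ne_zero
          exact smul_ne_zero h.ne' (norm_ne_zero_iff.1 this)
        have e1 : (2⁻¹ : ℝ) • (p z + q z) = (G z).1 := by
          simp only [p, q]
          rw [h1 _ hI, h1 _ (neg_mem_imagUnits hI), neg_mul]
          module
        have e2 : (2⁻¹ : ℝ) • (-unitI * (p z - q z)) = (G z).2 := by
          simp only [p, q]
          rw [h1 _ hI, h1 _ (neg_mem_imagUnits hI)]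
          have : (G z).1 + unitI * (G z).2 - ((G z).1 + -unitI * (G z).2)
            = (2 : ℝ) • (unitI * (G z).2) := by rw [neg_mul]; module
          rw [this, mul_smul_comm, ← mul_assoc, neg_mul, mul_self_of_mem_imagUnits hI, neg_neg,
            one_mul, smul_smul, inv_mul_cancel₀ two_ne_zero, one_smul]
        simp only [e1, e2]
        exact h1 J hJ

theorem laplacian_mem_axiallyMonogenic {D : Set ℂ} (hDo : IsOpen D) (hD : ConjInvariant D)
    {f : ℍ → ℍ} (hf : f ∈ sliceRegular D) : Laplacian.laplacian f ∈ axiallyMonogenic D := by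
  obtain ⟨F, hF, hh, hi⟩ := hf
  exact ⟨mem_sliceC1_of_eq_sliceMap hD (fun x hx =>
      (contDiffAt_laplacian_of_regular hDo hD hF hh hi hx).of_le one_le_two)
    (fun x hx hxi => laplacian_of_regular hDo hD hF hh hi hx hxi),
    isMonogenicOn_laplacian_of_regular hDo hD hF hh hi⟩

/-! ### Primitives with prescribed parity -/

/-- The `1`-form `p dα + q dβ`. -/
def planeForm {V : Type*} [NormedAddCommGroup V] [NormedSpace ℝ V] (p q : ℂ → V) (z : ℂ) :
    ℂ →L[ℝ] V :=
  Complex.reCLM.smulRight (p z) + Complex.imCLM.smulRight (q z)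

@[simp] theorem planeForm_apply {V : Type*} [NormedAddCommGroup V] [NormedSpace ℝ V] (p q : ℂ → V)
    (z v : ℂ) : planeForm p q z v = v.re • p z + v.im • q z := rfl

theorem HasFDerivAt.planeForm {V : Type*} [NormedAddCommGroup V] [NormedSpace ℝ V] {p q : ℂ → V}
    {p' q' : ℂ →L[ℝ] V} {z : ℂ} (hp : HasFDerivAt p p' z) (hq : HasFDerivAt q q' z) :
    HasFDerivAt (planeForm p q)
      ((ContinuousLinearMap.smulRightL ℝ ℂ V Complex.reCLM).comp p'
        + (ContinuousLinearMap.smulRightL ℝ ℂ V Complex.imCLM).comp q') z :=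
  ((ContinuousLinearMap.smulRightL ℝ ℂ V Complex.reCLM).hasFDerivAt.comp z hp).add
    ((ContinuousLinearMap.smulRightL ℝ ℂ V Complex.imCLM).hasFDerivAt.comp z hq)

/-- A closed form `p dα + q dβ` with `p` even and `q` odd has an even primitive. -/
theorem exists_even_primitive {V : Type*} [NormedAddCommGroup V] [NormedSpace ℝ V] [CompleteSpace V]
    {D : Set ℂ} (hDo : IsOpen D) (hD : ConjInvariant D)
    (hDs : ∀ z ∈ D, IsSimplyConnected (connectedComponentIn D z)) {p q : ℂ → V}
    (hp : ∀ z ∈ D, DifferentiableAt ℝ p z) (hq : ∀ z ∈ D, DifferentiableAt ℝ q z)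
    (hpq : ∀ z ∈ D, fderiv ℝ q z 1 = fderiv ℝ p z Complex.I)
    (hps : ∀ z ∈ D, p (star z) = p z) (hqs : ∀ z ∈ D, q (star z) = -q z) :
    ∃ u : ℂ → V, (∀ z ∈ D, HasFDerivAt u (planeForm p q z) z) ∧ ∀ z, u (star z) = u z := by
  have hω : ∀ z ∈ D, HasFDerivAt (planeForm p q) _ z := fun z hz =>
    HasFDerivAt.planeForm (hp z hz).hasFDerivAt (hq z hz).hasFDerivAt
  obtain ⟨u, hu⟩ := exists_forall_hasFDerivAt_of_isSimplyConnected_components (ω := planeForm p q)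
    hDs hDo (fun z hz => (hω z hz).differentiableAt.differentiableWithinAt) (by
      intro z hz v w
      have hlin : ∀ (L : ℂ →L[ℝ] V) (y : ℂ), L y = y.re • L 1 + y.im • L Complex.I := by
        intro L y
        conv_lhs => rw [← Complex.re_add_im y]
        rw [map_add, ← map_smul, ← map_smul]
        simp
      rw [(hω z hz).fderiv]
      change w.re • fderiv ℝ p z v + w.im • fderiv ℝ q z v
        = v.re • fderiv ℝ p z w + v.im • fderiv ℝ q z w
      rw [hlin (fderiv ℝ p z) v, hlin (fderiv ℝ q z) v, hlin (fderiv ℝ p z) w,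
        hlin (fderiv ℝ q z) w, hpq z hz]
      module)
  -- The form is invariant under pullback by conjugation, so averaging a primitive with its
  -- reflection gives an even one.
  refine ⟨fun z => (2⁻¹ : ℝ) • (u z + u (star z)), fun z hz => ?_, fun z => ?_⟩
  · have h1 : HasFDerivAt (fun w : ℂ => star w) (Complex.conjCLE : ℂ →L[ℝ] ℂ) z :=
      Complex.conjCLE.hasFDerivAt
    have h2 := ((hu z hz).add ((hu _ (hD z hz)).comp z h1)).const_smul (2⁻¹ : ℝ)
    refine h2.congr_fderiv ?_
    ext1 v
    have h3 := hps z hz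
    have h4 := hqs z hz
    rw [Complex.star_def] at h3 h4
    simp [h3, h4]
    module
  · simp only [star_star, add_comm]

/-! ### Surjectivity of the Laplacian -/

section Stem

variable {D : Set ℂ} {G : ℂ → ℍ × ℍ}

theorem IsStemOn.fderiv_star (hDo : IsOpen D) (hD : ConjInvariant D) (hG : IsStemOn G D)
    {z : ℂ} (hz : z ∈ D) (hd : DifferentiableAt ℝ G z) (v : ℂ) :
    fderiv ℝ G (star z) v = stemConj (fderiv ℝ G z (star v)) := by
  have h1 : HasFDerivAt (fun w : ℂ => star w) (Complex.conjCLE : ℂ →L[ℝ] ℂ) (star z) :=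
    Complex.conjCLE.hasFDerivAt
  have hd' : HasFDerivAt G (fderiv ℝ G z) (star (star z)) := by
    rw [star_star]; exact hd.hasFDerivAt
  have h2 := hd'.comp (star z) h1
  have h3 := h2.fst.prodMk h2.snd.neg
  have h4 : G =ᶠ[𝓝 (star z)] fun w => ((G (star w)).1, -(G (star w)).2) := by
    filter_upwards [hDo.mem_nhds (hD z hz)] with w hw
    have := hG _ (hD w hw)
    rw [star_star] at this
    exact this
  rw [(h3.congr_of_eventuallyEq h4).fderiv]
  simp [stemConj]

/-- The equations satisfied by the stem function of an axially monogenic function. -/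
theorem IsStemOn.monogenic_equations (hDo : IsOpen D) (hD : ConjInvariant D) (hG : IsStemOn G D)
    (hd : ∀ z ∈ D, DifferentiableAt ℝ G z) {g : ℍ → ℍ} (hi : IsInducedBy g G D)
    (hm : IsMonogenicOn g (axialSet D)) {z : ℂ} (hz : z ∈ D) :
    (fderiv ℝ G z 1).2 + (fderiv ℝ G z Complex.I).1 = 0 ∧
      z.im • ((fderiv ℝ G z 1).1 - (fderiv ℝ G z Complex.I).2) - (2 : ℝ) • (G z).2 = 0 := by
  have hpos : ∀ z ∈ D, 0 < z.im → (fderiv ℝ G z 1).2 + (fderiv ℝ G z Complex.I).1 = 0 ∧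
      z.im • ((fderiv ℝ G z 1).1 - (fderiv ℝ G z Complex.I).2) - (2 : ℝ) • (G z).2 = 0 := by
    intro z hz hzi
    have key : ∀ J ∈ imagUnits, ((fderiv ℝ G z 1).1 - (fderiv ℝ G z Complex.I).2
      - (2 * z.im⁻¹) • (G z).2) + J * ((fderiv ℝ G z 1).2 + (fderiv ℝ G z Complex.I).1) = 0 := by
      intro J hJ
      have hx := slicePoint_mem_axialSet hJ hz
      have hp : toPlane (slicePoint J z) = z := toPlane_slicePoint_of_nonneg hJ hzi.le
      have hxn : ‖(slicePoint J z).im‖ = z.im := by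
        rw [norm_im_slicePoint hJ, abs_of_pos hzi]
      have hxi : (slicePoint J z).im ≠ 0 := by
        rw [← norm_ne_zero_iff, hxn]; exact hzi.ne'
      have hev : g =ᶠ[𝓝 (slicePoint J z)] sliceMap G := by
        filter_upwards [(isOpen_axialSet hD hDo).mem_nhds hx] with y hy
          using hi.eq_sliceMap hG hD hy
      have h1 := (hm _ hx).2
      rw [cauchyRiemannFueter_eq, smul_eq_zero, fueterOp_congr hev,
        fueterOp_sliceMap hxi (by rw [hp]; exact hd z hz), hp, hxn,
        toUnit_slicePoint_of_pos hJ hzi] at h1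
      exact h1.resolve_left (by norm_num)
    -- Comparing J = i with J = -i separates the two components.
    have h1 := key _ unitI_mem_imagUnits
    have h2 := key _ (neg_mem_imagUnits unitI_mem_imagUnits)
    rw [neg_mul, ← sub_eq_add_neg, sub_eq_zero] at h2
    rw [h2, ← two_smul ℝ, smul_eq_zero] at h1
    have h3 := h1.resolve_left two_ne_zero
    rw [h3] at h2
    have hI : unitI ≠ 0 := fun h => by simpa using! congrArg QuaternionAlgebra.imI h
    refine ⟨(mul_eq_zero.1 h3).resolve_left hI, ?_⟩
    have h4 := congrArg (fun y => z.im • y) h2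
    simp only [smul_zero] at h4
    rw [← h4, smul_sub z.im (_ - _), smul_smul]
    congr 2
    field_simp
  -- The lower half plane follows by reflection. On the real axis every term of the first equation
  -- is odd, and the second, having been multiplied by β, is trivial.
  rcases lt_trichotomy z.im 0 with h | h | h
  · have h1 := hpos _ (hD z hz) (by simpa using h)
    rw [hG.fderiv_star hDo hD hz (hd z hz), hG.fderiv_star hDo hD hz (hd z hz), hG z hz] at h1
    simp only [stemConj, star_one, Complex.star_def, Complex.conj_I, map_neg, Prod.fst_neg,
      Prod.snd_neg, neg_neg, Complex.conj_im] at h1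
    refine ⟨?_, ?_⟩
    · rw [← neg_eq_zero, neg_add]; exact h1.1
    · rw [← neg_eq_zero, ← h1.2]; module
  · have hs : star z = z := Complex.conj_eq_iff_im.2 h
    have h1 := congrArg Prod.snd (hG.fderiv_star hDo hD hz (hd z hz) 1)
    have h2 := congrArg Prod.fst (hG.fderiv_star hDo hD hz (hd z hz) Complex.I)
    rw [hs] at h1 h2
    simp only [stemConj, star_one, Complex.star_def, Complex.conj_I, map_neg, Prod.fst_neg] at h1 h2
    have hz0 : ∀ y : ℍ, y = -y → y = 0 := fun y hy => by
      have : (2 : ℝ) • y = 0 := by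
        rw [two_smul]; nth_rewrite 1 [hy]; exact neg_add_cancel _
      exact (smul_eq_zero.1 this).resolve_left two_ne_zero
    rw [hz0 _ h1, hz0 _ h2, hG.snd_eq_zero hz h, h]
    simp
  · exact hpos z hz h

/-- Every axially monogenic function is the Laplacian of a slice regular function. -/
theorem exists_laplacian_eqOn (hDo : IsOpen D) (hD : ConjInvariant D)
    (hDs : ∀ z ∈ D, IsSimplyConnected (connectedComponentIn D z)) {g : ℍ → ℍ}
    (hg : g ∈ axiallyMonogenic D) :
    ∃ f ∈ sliceRegular D, EqOn (Laplacian.laplacian f) g (axialSet D) := by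
  obtain ⟨⟨G, hG, hGc, hi⟩, hm⟩ := hg
  have hd : ∀ z ∈ D, DifferentiableAt ℝ G z := fun z hz =>
    (hGc.contDiffAt (hDo.mem_nhds hz)).differentiableAt one_ne_zero
  have heq := fun z hz => hG.monogenic_equations hDo hD hd hi hm (z := z) hz
  have hA : ∀ z ∈ D, HasFDerivAt (fun w => (G w).1) _ z := fun z hz => (hd z hz).hasFDerivAt.fst
  have hB : ∀ z ∈ D, HasFDerivAt (fun w => (G w).2) _ z := fun z hz => (hd z hz).hasFDerivAt.snd
  have hAs : ∀ z ∈ D, (G (star z)).1 = (G z).1 := fun z hz => by rw [hG z hz]; rfl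
  have hBs : ∀ z ∈ D, (G (star z)).2 = -(G z).2 := fun z hz => by rw [hG z hz]; rfl
  have him : ∀ z : ℂ, HasFDerivAt (fun w : ℂ => w.im) Complex.imCLM z := fun z =>
    Complex.imCLM.hasFDerivAt
  -- h is chosen so that -2∂_αh = G₁ and 2∂_βh = G₂, matching `laplacianStem`.
  obtain ⟨h, hh, hhs⟩ := exists_even_primitive hDo hD hDs
    (p := fun z => (-2⁻¹ : ℝ) • (G z).1) (q := fun z => (2⁻¹ : ℝ) • (G z).2)
    (fun z hz => ((hA z hz).const_smul (-2⁻¹ : ℝ)).differentiableAt)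
    (fun z hz => ((hB z hz).const_smul (2⁻¹ : ℝ)).differentiableAt)
    (fun z hz => by
      have e1 := ((hA z hz).const_smul (-2⁻¹ : ℝ)).fderiv
      have e2 := ((hB z hz).const_smul (2⁻¹ : ℝ)).fderiv
      refine (DFunLike.congr_fun e2 1).trans (Eq.trans ?_ (DFunLike.congr_fun e1 Complex.I).symm)
      simp only [smul_apply, ContinuousLinearMap.comp_apply, ContinuousLinearMap.coe_fst',
        ContinuousLinearMap.coe_snd']
      rw [eq_neg_of_add_eq_zero_left (heq z hz).1]
      module)
    (fun z hz => by simp only [hAs z hz]) (fun z hz => by simp only [hBs z hz, smul_neg])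
  -- The Cauchy-Riemann equations for (u, βh) ask that u_α = ∂_β(βh) = h + βG₂/2 and u_β = -∂_α(βh)
  -- = βG₁/2.
  have hp : ∀ z ∈ D, HasFDerivAt (fun w => h w + (2⁻¹ * w.im) • (G w).2) _ z := fun z hz =>
    (hh z hz).add (((him z).const_mul (2⁻¹ : ℝ)).smul (hB z hz))
  have hq : ∀ z ∈ D, HasFDerivAt (fun w => (2⁻¹ * w.im) • (G w).1) _ z := fun z hz =>
    ((him z).const_mul (2⁻¹ : ℝ)).smul (hA z hz)
  obtain ⟨u, hu, hus⟩ := exists_even_primitive hDo hD hDs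
    (fun z hz => (hp z hz).differentiableAt) (fun z hz => (hq z hz).differentiableAt)
    (fun z hz => by
      rw [(hp z hz).fderiv, (hq z hz).fderiv]
      -- Closedness reads βA_α/2 = B + βB_β/2 for G = (A, B), which is half of the second
      -- monogenicity equation.
      have e := (heq z hz).2
      rw [smul_sub, sub_sub, sub_eq_zero] at e
      simp
      rw [mul_smul, e]
      module)
    (fun z hz => by simp only [hhs, hBs z hz]; simp)
    (fun z hz => by simp only [hAs z hz]; simp)
  set F : ℂ → ℍ × ℍ := fun z => (u z, z.im • h z)
  have hF : IsStemOn F D := fun z hz => by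
    ext1
    · exact hus z
    · simp only [F, hhs]
      simp [stemConj]
  have hFd : ∀ z ∈ D, HasFDerivAt F _ z := fun z hz => (hu z hz).prodMk ((him z).smul (hh z hz))
  have hFh : IsHolomorphicStemOn F D := by
    intro z hz
    refine ⟨(hFd z hz).differentiableAt, fun v => ?_⟩
    rw [(hFd z hz).fderiv]
    ext1
    · simp [stemMulI]
      module
    · simp [stemMulI]
      module
  have hf := hF.isInducedBy_sliceMap hD
  refine ⟨sliceMap F, ⟨F, hF, hFh, hf⟩, ?_⟩
  -- Both sides are continuous on Ω, so nonreal points suffice; there the spherical derivative of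
  -- `F` is h.
  refine eq_of_eqOn_im_ne_zero hD hDo
    (fun x hx =>
      (contDiffAt_laplacian_of_regular hDo hD hF hFh hf hx).continuousAt.continuousWithinAt)
    (fun x hx => (hm x hx).1.continuousAt.continuousWithinAt) fun x hx hxi => ?_
  rw [laplacian_of_regular hDo hD hF hFh hf hx hxi, hi.eq_sliceMap hG hD hx, sliceMap, sliceMap]
  have hz := (mem_axialSet_iff hD).1 hx
  have hev : sphericalDeriv F =ᶠ[𝓝 (toPlane x)] h := by
    filter_upwards [(isOpen_ne.preimage Complex.continuous_im).mem_nhds (toPlane_im_ne_zero hxi)]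
      with w hw
    simp only [sphericalDeriv, F]
    rw [smul_smul, inv_mul_cancel₀ hw, one_smul]
  simp [laplacianStem, hev.fderiv_eq, (hh _ hz).fderiv, smul_smul]

end Stem

end SliceQuaternion

end

theorem mainTheorem4 (D : Set ℂ) (hDopen : IsOpen D)
    (hDconj : SliceQuaternion.ConjInvariant D)
    (hDsc : ∀ z ∈ D, IsSimplyConnected (connectedComponentIn D z)) :
    (∀ f ∈ SliceQuaternion.sliceRegular D,
      ContDiffOn ℝ 2 f (SliceQuaternion.axialSet D) ∧
        Laplacian.laplacian f ∈ SliceQuaternion.axiallyMonogenic D) ∧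
    (∀ g ∈ SliceQuaternion.axiallyMonogenic D,
      ∃ f ∈ SliceQuaternion.sliceRegular D,
        Set.EqOn (Laplacian.laplacian f) g (SliceQuaternion.axialSet D)) := by
  refine ⟨fun f hf => ⟨?_, SliceQuaternion.laplacian_mem_axiallyMonogenic hDopen hDconj hf⟩,
    fun g hg => SliceQuaternion.exists_laplacian_eqOn hDopen hDconj hDsc hg⟩
  obtain ⟨F, hF, hh, hi⟩ := hf
  exact fun x hx =>
    (SliceQuaternion.contDiffAt_of_regular hDopen hDconj hF hh hi hx 2).contDiffWithinAt
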